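/- Let $(\Omega,\mathcal A,P)$ be a probability space with a right-continuous filtration $(\mathcal A_t)_{t\ge 0}$, and let $V$ be an adapted process with increasing, right-continuous paths. Let $X^1,\dots,X^m$ be nonnegative, adapted, continuous semimartingales with multiplicative Doob–Meyer decompositions $$X^i_t=M^i_t\exp\Big(\int_0^t\frac{Y^i_s}{X^i_s}\,dV_s\Big),\qquad t\ge 0,\quad i=1,\dots,m,$$ almost surely, where each $M^i$ is a continuous martingale and $\frac{Y^i}{X^i}$ denotes a real-valued progressive process $R^i$ with $R^iX^i=Y^i$ (so $R^i$ is the quotient wherever $X^i\ne0$), such that $t\mapsto \frac{Y^i_t}{X^i_t}$ is non-increasing. Let the $X^i$, together with their martingale parts, be independent, i.e. the processes $(X^1,M^1),\dots,(X^m,M^m)$ are independent. Put $$X=\prod_{i=1}^mX^i,\qquad Y=\sum_{i=1}^mY^i\prod_{j\ne i}X^j,\qquad \tau^*=\inf\Big\{t\ge0:\ \sum_{i=1}^m\frac{Y^i_t}{X^i_t}\le 0\Big\}\quad(\inf\emptyset=\infty).$$ Then: (i) The product problem is a monotone case problem with myopic rule $\tau^*$. That is: $X$ has the multiplicative Doob–Meyer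 decomposition $X_t=\big(\prod_{i}M^i_t\big)\exp\big(\int_0^t\sum_{i}\frac{Y^i_s}{X^i_s}\,dV_s\big)$ almost surely, where $\prod_iM^i$ is a continuous martingale, and the additive one $X_t=X_0+N_t+\int_0^tY_s\,dV_s$, where $N$ is a local martingale with $N_0=0$ and $\int Y\,dV$ is adapted and almost surely continuous; almost surely, $Y_t\le 0$ for all $t>\inf\{s:Y_s\le 0\}$; $\tau^*$ is a stopping time and $\sum_i\frac{Y^i_t}{X^i_t}\le 0$ for all $t>\tau^*$; and $\inf\{t:Y_t\le 0\}=\min(\tau^*,\inf\{t:X_t=0\})$, which is $\tau^*$ if $X$ is positive. (ii) For a stopping time $\tau$ with values in $[0,\infty]$ let $EX_\tau\in[0,\infty]$ be the expected gain, with $X_\infty=\liminf_{t\to\infty}X_t$. If $$\lim_{L\to\infty}EX_{\min\{\tau^*,L\}}\ \text{ exists in } [0,\infty]\ \text{ and is } \le\ EX_{\tau^*},\tag{V1}$$ then $\tau^*$ is optimal: $EX_{\tau^*}=\sup_\tau EX_\tau$, where $\tau$ runs through all stopping times. -/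

import Mathlib

open MeasureTheory ProbabilityTheory Filter Topology
open scoped NNReal ENNReal

namespace MonotoneStopping

variable {Ω : Type*} {m0 : MeasurableSpace Ω}

/-- The pathwise Lebesgue-Stieltjes integral `∫₀ᵗ H_s dV_s` (over `(0, t]`) of a process `H` with
respect to the process `V`, all of whose paths are increasing and right-continuous. -/
noncomputable def stieltjesIntegral (V : Ω → StieltjesFunction ℝ≥0) (H : ℝ≥0 → Ω → ℝ)
    (t : ℝ≥0) (ω : Ω) : ℝ :=
  ∫ s in Set.Ioc 0 t, H s ω ∂(V ω).measure

/-- Every path of `H` is integrable with respect to `dV` on every interval `(0, t]`. -/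
def LocallyIntegrable (V : Ω → StieltjesFunction ℝ≥0) (H : ℝ≥0 → Ω → ℝ) : Prop :=
  ∀ ω t, IntegrableOn (fun s => H s ω) (Set.Ioc 0 t) (V ω).measure

/-- The continuous process `X` has the (additive) Doob-Meyer decomposition
`X_t = X_0 + N_t + ∫₀ᵗ Y_s dV_s`: the drift `∫ Y dV` is well defined, adapted and (almost surely)
continuous, and `N = X - X_0 - ∫ Y dV`, which vanishes at time `0`, is a local martingale. -/
structure HasDoobMeyer (𝓕 : Filtration ℝ≥0 m0) (P : Measure Ω)
    (V : Ω → StieltjesFunction ℝ≥0) (X Y : ℝ≥0 → Ω → ℝ) : Prop where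
  adapted : StronglyAdapted 𝓕 X
  continuous : ∀ ω, Continuous fun t => X t ω
  locallyIntegrable : LocallyIntegrable V Y
  adapted_drift : StronglyAdapted 𝓕 (stieltjesIntegral V Y)
  continuous_drift : ∀ᵐ ω ∂P, Continuous fun t => stieltjesIntegral V Y t ω
  localMartingale :
    Locally (fun N => Martingale N 𝓕 P) 𝓕 (fun t ω => X t ω - X 0 ω - stieltjesIntegral V Y t ω) P

/-- The nonnegative continuous process `X` has the multiplicative Doob-Meyer decomposition
`X_t = M_t * exp (∫₀ᵗ (Y_s / X_s) dV_s)` with a continuous martingale `M`. The quotient `Y / X` is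
the process `R`: it satisfies `R * X = Y`, that is `R = Y / X` wherever `X ≠ 0`. -/
structure HasMulDoobMeyer (𝓕 : Filtration ℝ≥0 m0) (P : Measure Ω)
    (V : Ω → StieltjesFunction ℝ≥0) (X M Y R : ℝ≥0 → Ω → ℝ) : Prop where
  nonneg : ∀ t ω, 0 ≤ X t ω
  adapted : StronglyAdapted 𝓕 X
  continuous : ∀ ω, Continuous fun t => X t ω
  martingale : Martingale M 𝓕 P
  continuous_martingale : ∀ ω, Continuous fun t => M t ω
  progressive : IsStronglyProgressive 𝓕 R
  locallyIntegrable : LocallyIntegrable V R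
  quotient : ∀ t ω, R t ω * X t ω = Y t ω
  eq_mul_exp : ∀ᵐ ω ∂P, ∀ t, X t ω = M t ω * Real.exp (stieltjesIntegral V R t ω)

/-- The first time `inf {t : Z_t ≤ 0}`, which is `⊤` if there is no such `t`. For the drift rate `Z`
of a gain process this is the myopic (infinitesimal look ahead) rule. -/
noncomputable def myopicTime (Z : ℝ≥0 → Ω → ℝ) : Ω → WithTop ℝ≥0 :=
  hittingAfter Z (Set.Iic 0) 0

/-- The stopping problem with gain `X` is a monotone case problem: `X_t = X_0 + N_t + ∫₀ᵗ Y_s dV_s`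
is its Doob-Meyer decomposition, and `Y_t ≤ 0` for all `t > inf {s : Y_s ≤ 0}`. -/
structure IsMonotoneCase (𝓕 : Filtration ℝ≥0 m0) (P : Measure Ω)
    (V : Ω → StieltjesFunction ℝ≥0) (X Y : ℝ≥0 → Ω → ℝ) : Prop where
  doobMeyer : HasDoobMeyer 𝓕 P V X Y
  monotone : ∀ᵐ ω ∂P, ∀ t : ℝ≥0, myopicTime Y ω < t → Y t ω ≤ 0

open Classical in
/-- The gain `X_τ ∈ [0, ∞]` of a nonnegative process `X` stopped at `τ`, where
`X_∞ = liminf_{t → ∞} X_t`. -/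
noncomputable def gainAt (X : ℝ≥0 → Ω → ℝ) (τ : Ω → WithTop ℝ≥0) (ω : Ω) : ℝ≥0∞ :=
  if τ ω = ⊤ then liminf (fun t : ℝ≥0 => ENNReal.ofReal (X t ω)) atTop
  else ENNReal.ofReal (stoppedValue X τ ω)

/-- The expected gain `E X_τ ∈ [0, ∞]` of a nonnegative process `X`. -/
noncomputable def expectedGain (P : Measure Ω) (X : ℝ≥0 → Ω → ℝ) (τ : Ω → WithTop ℝ≥0) : ℝ≥0∞ :=
  ∫⁻ ω, gainAt X τ ω ∂P

/-- Condition (V1) for the gain `X` and the rule `τ`: `lim_{L → ∞} E X_{min (τ, L)} ≤ E X_τ`. -/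
def ConditionV1 (P : Measure Ω) (X : ℝ≥0 → Ω → ℝ) (τ : Ω → WithTop ℝ≥0) : Prop :=
  ∃ l : ℝ≥0∞,
    Tendsto (fun L : ℝ≥0 => expectedGain P X fun ω => min (τ ω) (L : WithTop ℝ≥0)) atTop (𝓝 l) ∧
      l ≤ expectedGain P X τ

/-- `τ` is an optimal stopping time: `E X_τ = sup_σ E X_σ`, where `σ` runs through all stopping
times, which may take the value `∞`. -/
def IsOptimal (𝓕 : Filtration ℝ≥0 m0) (P : Measure Ω) (X : ℝ≥0 → Ω → ℝ)
    (τ : Ω → WithTop ℝ≥0) : Prop :=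
  IsStoppingTime 𝓕 τ ∧
    expectedGain P X τ = ⨆ (σ : Ω → WithTop ℝ≥0) (_ : IsStoppingTime 𝓕 σ), expectedGain P X σ

/-- The product `∏ᵢ Xⁱ` of finitely many processes. -/
def prodProcess {m : ℕ} (X : Fin m → ℝ≥0 → Ω → ℝ) (t : ℝ≥0) (ω : Ω) : ℝ :=
  ∏ i, X i t ω

/-- The sum `∑ᵢ Rⁱ` of finitely many processes. -/
def sumProcess {m : ℕ} (R : Fin m → ℝ≥0 → Ω → ℝ) (t : ℝ≥0) (ω : Ω) : ℝ :=
  ∑ i, R i t ω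

/-- The drift rate `∑ᵢ Yⁱ ∏_{j ≠ i} Xʲ` of the product `∏ᵢ Xⁱ`. -/
def prodDrift {m : ℕ} (X Y : Fin m → ℝ≥0 → Ω → ℝ) (t : ℝ≥0) (ω : Ω) : ℝ :=
  ∑ i, Y i t ω * ∏ j ∈ Finset.univ.erase i, X j t ω

end MonotoneStopping

namespace MonotoneStopping

variable {Ω : Type*} {m0 : MeasurableSpace Ω}

/-! ### Hitting times and approximation of stopping times from above. -/

section StoppingTimes

variable {𝓕 : Filtration ℝ≥0 m0}

/-! Multiplying the decompositions adds the exponents, so everything reduces to one process `X = M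
exp A`, `A = ∫ R dV`, with antitone `R`, once `∏ Mⁱ` is known to be a martingale for `𝓕`.
Independence of the processes does not make conditional expectations given `𝓕 s` factor, so this
needs an argument (`Martingale.mul_of_indepFun`). For bounded `M`, `N` and `A ∈ 𝓕 s`, the change of
`E[1_A M N]` from `s` to `t` is `E[1_A ∑ ΔM ΔN]`. Independence and orthogonality of increments give
`E(∑ ΔM ΔN)² = ∑ E(ΔM)² E(ΔN)²`, which tends to `0` with the mesh. Truncation and L¹ convergence
remove the bound.

The additive decomposition (`Martingale.sub_drift_of_bounded`) comes from telescoping `ΔX = ΔM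
exp(A_k) + X_{k+1} (1 - exp(-ΔA))`: the first terms integrate to zero over events of the past, the
second ones sum up to `∫ X R dV` in the limit. `V` may have atoms, but continuity of `X` and `M`
forces `R = 0` at every atom `u > 0` with `X_u ≠ 0`. The general case follows by localization.

Since `Y = R X` and `X ≥ 0`, `Y ≤ 0` means `R ≤ 0` or `X = 0`. The first persists because `R` is
antitone, the second almost surely because the nonnegative martingale `M` is absorbed at `0`.

Optimality is proved without the additive decomposition. Where `M ≠ 0`, `X / M = exp A` is
nondecreasing up to `τ*` and nonincreasing afterwards. For a stopping time `s ≤ L`, `t = min τ* L`,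
`ρ = min s t` and `f = X_ρ / M_ρ`, this gives `X_s ≤ M_s f` and `M_t f ≤ X_t`. As `f` is known at
time `ρ`, optional sampling yields `E M_s f = E M_L f = E M_t f`, so `E X_s ≤ E X_t`
(`HasMulDoobMeyer.expectedGain_min_le`). Fatou's lemma and (V1) let `L → ∞`. -/

theorem isStoppingTime_hittingAfter_of_dense [𝓕.IsRightContinuous] {Z : ℝ≥0 → Ω → ℝ}
    (hZ : StronglyAdapted 𝓕 Z) {S D : Set _} (hS : MeasurableSet S) (hD : D.Countable)
    (h : ∀ ω s t, s < t → Z s ω ∈ S → ∃ q ∈ D, q < t ∧ Z q ω ∈ S) :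
    IsStoppingTime 𝓕 (hittingAfter Z S 0) := by
  -- By right-continuity of `𝓕` only the events `{τ < t}` matter, and the countable set `D` already
  -- detects an entrance before `t`.
  refine isStoppingTime_of_measurableSet_lt_of_isRightContinuous fun t => ?_
  have : {ω | hittingAfter Z S 0 ω < t} = ⋃ q ∈ D ∩ Set.Iio t, Z q ⁻¹' S := by
    ext ω
    simp only [Set.mem_ofPred_eq, hittingAfter_lt_iff, Set.mem_iUnion, Set.mem_preimage]
    constructor
    · rintro ⟨s, hs, hsS⟩
      obtain ⟨q, hq, hqt, hqS⟩ := h ω s t hs.2 hsS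
      exact ⟨q, ⟨hq, hqt⟩, hqS⟩
    · rintro ⟨q, hq, hqS⟩
      exact ⟨q, ⟨zero_le, hq.2⟩, hqS⟩
  rw [this]
  exact MeasurableSet.biUnion (hD.mono Set.inter_subset_left) fun q hq =>
    ((hZ q).measurable.mono (𝓕.mono (le_of_lt hq.2)) le_rfl) hS

theorem isStoppingTime_hittingAfter_of_isOpen [𝓕.IsRightContinuous] {Z : ℝ≥0 → Ω → ℝ}
    (hZ : StronglyAdapted 𝓕 Z) (hc : ∀ ω, Continuous fun t => Z t ω) {S : Set ℝ} (hS : IsOpen S) :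
    IsStoppingTime 𝓕 (hittingAfter Z S 0) := by
  obtain ⟨D, hD, hd⟩ := TopologicalSpace.exists_countable_dense ℝ≥0
  refine isStoppingTime_hittingAfter_of_dense hZ hS.measurableSet hD fun ω s t hst hs => ?_
  obtain ⟨q, hq, hqD⟩ := hd.exists_mem_open (isOpen_Iio.inter (hS.preimage (hc ω)))
    (⟨s, hst, hs⟩ : (Set.Iio t ∩ (fun t => Z t ω) ⁻¹' S).Nonempty)
  exact ⟨q, hq, hqD.1, hqD.2⟩

/-- No path continuity is needed: an antitone path that has entered `Iic c` stays there, so any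
later point of a dense set sees it. -/
theorem isStoppingTime_hittingAfter_of_antitone [𝓕.IsRightContinuous] {Z : ℝ≥0 → Ω → ℝ}
    (hZ : StronglyAdapted 𝓕 Z) (hc : ∀ ω, Antitone fun t => Z t ω) (c : ℝ) :
    IsStoppingTime 𝓕 (hittingAfter Z (Set.Iic c) 0) := by
  obtain ⟨D, hD, hd⟩ := TopologicalSpace.exists_countable_dense ℝ≥0
  refine isStoppingTime_hittingAfter_of_dense hZ measurableSet_Iic hD fun ω s t hst hs => ?_
  obtain ⟨q, hq, hqD⟩ := hd.exists_between hst
  exact ⟨q, hq, hqD.2, (hc ω hqD.1.le).trans hs⟩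

theorem mem_closure_of_hittingAfter_eq {Z : ℝ≥0 → Ω → ℝ} {ω : Ω}
    (hc : Continuous fun t => Z t ω) {S : Set ℝ} {t : ℝ≥0} (h : hittingAfter Z S 0 ω = t) :
    Z t ω ∈ closure S := by
  have hex : ∃ j, 0 ≤ j ∧ Z j ω ∈ S := by
    by_contra hne
    push Not at hne
    rw [hittingAfter_eq_top_iff.2 hne] at h
    exact WithTop.top_ne_coe h
  have ht : t = sInf {i | 0 ≤ i ∧ Z i ω ∈ S} := by
    rw [hittingAfter, if_pos hex] at h
    exact_mod_cast h.symm
  have : t ∈ closure {i | 0 ≤ i ∧ Z i ω ∈ S} := ht ▸ csInf_mem_closure hex (OrderBot.bddBelow _)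
  exact map_mem_closure (f := fun t => Z t ω) hc this fun i hi => hi.2

theorem notMem_closure_of_lt_hittingAfter {Z : ℝ≥0 → Ω → ℝ} {S : Set ℝ} {t : ℝ≥0} {ω : Ω}
    (h : (t : WithTop ℝ≥0) < hittingAfter Z S 0 ω) : Z t ω ∉ S :=
  notMem_of_lt_hittingAfter h zero_le

/-- Rounding `x` up to the next point of the grid of mesh `1 / (n + 1)`, strictly above `x`. -/
noncomputable def gridAbove (n : ℕ) (x : ℝ≥0) : ℝ≥0 := (⌊(n + 1) * x⌋₊ + 1) / (n + 1)

theorem lt_gridAbove (n : ℕ) (x : ℝ≥0) : x < gridAbove n x := by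
  rw [gridAbove, lt_div_iff₀ (by positivity), mul_comm]
  exact Nat.lt_floor_add_one _

theorem gridAbove_le (n : ℕ) (x : ℝ≥0) : gridAbove n x ≤ x + 1 / (n + 1) := by
  rw [gridAbove, div_le_iff₀ (by positivity), add_mul x, one_div, inv_mul_cancel₀ (by positivity),
    mul_comm x]
  gcongr
  exact Nat.floor_le zero_le

theorem tendsto_gridAbove (x : ℝ≥0) : Tendsto (fun n => gridAbove n x) atTop (𝓝 x) := by
  refine tendsto_of_tendsto_of_tendsto_of_le_of_le tendsto_const_nhds ?_
    (fun n => (lt_gridAbove n x).le) (fun n => gridAbove_le n x)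
  have : Tendsto (fun n : ℕ => x + 1 / ((n : ℝ≥0) + 1)) atTop (𝓝 (x + 0)) :=
    tendsto_const_nhds.add tendsto_one_div_add_atTop_nhds_zero_nat
  simpa using this

/-- Rounding strictly upwards turns the event into `x < g` with `g` the last grid point up to `i`,
which is decided by time `i`. -/
theorem gridAbove_le_iff (n : ℕ) (x i : ℝ≥0) :
    gridAbove n x ≤ i ↔ x < ⌊(n + 1) * i⌋₊ / (n + 1) := by
  rw [gridAbove, div_le_iff₀ (by positivity), lt_div_iff₀ (by positivity), mul_comm i, mul_comm x,
    ← Nat.floor_lt zero_le, Nat.lt_iff_add_one_le, Nat.le_floor_iff zero_le]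
  push_cast
  rfl

theorem isStoppingTime_gridAbove {σ : Ω → ℝ≥0} (hσ : IsStoppingTime 𝓕 fun ω => (σ ω : WithTop ℝ≥0))
    (n : ℕ) : IsStoppingTime 𝓕 fun ω => (gridAbove n (σ ω) : WithTop ℝ≥0) := by
  intro i
  simp only [WithTop.coe_le_coe, gridAbove_le_iff]
  have := hσ.measurableSet_lt (⌊((n : ℝ≥0) + 1) * i⌋₊ / (n + 1))
  simp only [WithTop.coe_lt_coe] at this
  refine 𝓕.mono ?_ _ this
  rw [div_le_iff₀ (by positivity), mul_comm i]
  exact Nat.floor_le zero_le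

end StoppingTimes

/-! ### Optional sampling and stopping for continuous martingales. -/

section OptionalSampling

variable {𝓕 : Filtration ℝ≥0 m0} {P : Measure Ω} [IsFiniteMeasure P] {M : ℝ≥0 → Ω → ℝ}

theorem exists_seq_countable_range_tendsto {σ : Ω → ℝ≥0} {L : ℝ≥0}
    (hσ : IsStoppingTime 𝓕 fun ω => (σ ω : WithTop ℝ≥0)) (hL : ∀ ω, σ ω ≤ L) :
    ∃ s : ℕ → Ω → ℝ≥0, (∀ n, IsStoppingTime 𝓕 fun ω => (s n ω : WithTop ℝ≥0)) ∧
      (∀ n ω, σ ω ≤ s n ω) ∧ (∀ n ω, s n ω ≤ L) ∧ (∀ n, (Set.range (s n)).Countable) ∧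
      ∀ ω, Tendsto (fun n => s n ω) atTop (𝓝 (σ ω)) := by
  refine ⟨fun n ω => min (gridAbove n (σ ω)) L, fun n => ?_, fun n ω => ?_, fun n ω => ?_,
    fun n => ?_, fun ω => ?_⟩
  · simpa using (isStoppingTime_gridAbove hσ n).min_const L
  · exact le_min (lt_gridAbove _ _).le (hL ω)
  · exact min_le_right _ _
  · refine (Set.countable_range fun k : ℕ => min (((k : ℝ≥0) + 1) / (n + 1)) L).mono ?_
    rintro _ ⟨ω, rfl⟩
    exact ⟨_, rfl⟩
  · simpa [min_eq_left (hL ω)] using (tendsto_gridAbove (σ ω)).min (tendsto_const_nhds (x := L))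

/-- Optional sampling at a bounded time. For approximating times with countable range, the sampled
values are conditional expectations of `M L`, hence uniformly integrable; path continuity gives
their limit, so they converge in L¹. Events of the σ-algebra at `σ` also belong to those at the
later times, so the integrals pass to the limit. -/
theorem Martingale.stoppedValue_coe_ae_eq_condExp (hM : Martingale M 𝓕 P)
    (hc : ∀ ω, Continuous fun t => M t ω) {σ : Ω → ℝ≥0} {L : ℝ≥0}
    (hσ : IsStoppingTime 𝓕 fun ω => (σ ω : WithTop ℝ≥0)) (hL : ∀ ω, σ ω ≤ L) :
    (fun ω => M (σ ω) ω) =ᵐ[P] P[M L | hσ.measurableSpace] := by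
  obtain ⟨s, hs, hσs, hsL, hsc, hst⟩ := exists_seq_countable_range_tendsto hσ hL
  have hprog := hM.stronglyAdapted.isStronglyProgressive_of_continuous hc
  have hce : ∀ n, P[M L | (hs n).measurableSpace] =ᵐ[P] fun ω => M (s n ω) ω := fun n =>
    (hM.stoppedValue_ae_eq_condExp_of_le_const_of_countable_range (hs n)
      (fun ω => by exact_mod_cast hsL n ω)
      (by rw [Set.range_comp' WithTop.some (s n)]; exact (hsc n).image _)).symm
  have hmeas : ∀ {τ : Ω → ℝ≥0}, IsStoppingTime 𝓕 (fun ω => (τ ω : WithTop ℝ≥0)) → (∀ ω, τ ω ≤ L) →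
      StronglyMeasurable fun ω => M (τ ω) ω := fun {τ} hτ hτL =>
    (stronglyMeasurable_stoppedValue_of_le hprog hτ (n := L)
      fun ω => by exact_mod_cast hτL ω).mono (𝓕.le _)
  have hui : UniformIntegrable (fun n ω => M (s n ω) ω) 1 P :=
    ((hM.integrable L).uniformIntegrable_condExp fun n => (hs n).measurableSpace_le).ae_eq hce
  have hlim : ∀ᵐ ω ∂P, Tendsto (fun n => M (s n ω) ω) atTop (𝓝 (M (σ ω) ω)) :=
    ae_of_all _ fun ω => ((hc ω).tendsto _).comp (hst ω)
  have hmem : MemLp (fun ω => M (σ ω) ω) 1 P :=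
    hui.memLp_of_ae_tendsto hlim
  have hL1 := tendsto_Lp_finite_of_tendsto_ae (μ := P) le_rfl ENNReal.one_ne_top
    (fun n => (hmeas (hs n) (hsL n)).aestronglyMeasurable) hmem hui.unifIntegrable hlim
  have hint := memLp_one_iff_integrable.1 hmem
  refine ae_eq_condExp_of_forall_setIntegral_eq hσ.measurableSpace_le (hM.integrable L)
    (fun _ _ _ => hint.integrableOn) (fun A hA _ => ?_) ?_
  · have h1 := tendsto_setIntegral_of_L1' _ hint.aestronglyMeasurable
      (Eventually.of_forall fun n => ((integrable_congr (hce n)).1 integrable_condExp)) hL1 A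
    refine tendsto_nhds_unique h1 (tendsto_const_nhds.congr fun n => ?_)
    have hA' : MeasurableSet[(hs n).measurableSpace] A :=
      hσ.measurableSpace_mono (hs n) (fun ω => WithTop.coe_le_coe.2 (hσs n ω)) A hA
    rw [← setIntegral_condExp (hs n).measurableSpace_le (hM.integrable L) hA']
    exact setIntegral_congr_ae ((hs n).measurableSpace_le _ hA') ((hce n).mono fun ω h _ => h)
  · exact (measurable_stoppedValue hprog hσ).stronglyMeasurable.aestronglyMeasurable

theorem martingale_of_setIntegral_eq {f : ℝ≥0 → Ω → ℝ} (hf : StronglyAdapted 𝓕 f)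
    (hint : ∀ t, Integrable (f t) P)
    (h : ∀ s t, s ≤ t → ∀ A, MeasurableSet[𝓕 s] A → ∫ ω in A, f s ω ∂P = ∫ ω in A, f t ω ∂P) :
    Martingale f 𝓕 P :=
  ⟨hf, fun s t hst => (ae_eq_condExp_of_forall_setIntegral_eq (𝓕.le s) (hint t)
    (fun _ _ _ => (hint s).integrableOn) (fun A hA _ => h s t hst A hA)
    (hf s).aestronglyMeasurable).symm⟩

theorem Martingale.integrable_stopped (hM : Martingale M 𝓕 P)
    (hc : ∀ ω, Continuous fun t => M t ω) {σ : Ω → ℝ≥0} {L : ℝ≥0}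
    (hσ : IsStoppingTime 𝓕 fun ω => (σ ω : WithTop ℝ≥0)) (hL : ∀ ω, σ ω ≤ L) :
    Integrable (fun ω => M (σ ω) ω) P :=
  (integrable_congr (Martingale.stoppedValue_coe_ae_eq_condExp hM hc hσ hL)).2 integrable_condExp

theorem Martingale.setIntegral_stopped (hM : Martingale M 𝓕 P)
    (hc : ∀ ω, Continuous fun t => M t ω) {σ : Ω → ℝ≥0} {L : ℝ≥0}
    (hσ : IsStoppingTime 𝓕 fun ω => (σ ω : WithTop ℝ≥0)) (hL : ∀ ω, σ ω ≤ L) {A : Set Ω}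
    (hA : MeasurableSet[hσ.measurableSpace] A) :
    ∫ ω in A, M (σ ω) ω ∂P = ∫ ω in A, M L ω ∂P := by
  rw [← setIntegral_condExp hσ.measurableSpace_le (hM.integrable L) hA]
  exact setIntegral_congr_ae (hσ.measurableSpace_le _ hA)
    ((Martingale.stoppedValue_coe_ae_eq_condExp hM hc hσ hL).mono fun ω h _ => h)

/-- The measures with densities `M_σ` and `M_L` agree on the σ-algebra at `σ`; formulated this way,
no integrability of `f` is required. -/
theorem Martingale.lintegral_mul_stopped (hM : Martingale M 𝓕 P)
    (hc : ∀ ω, Continuous fun t => M t ω) (h0 : ∀ᵐ ω ∂P, ∀ t, 0 ≤ M t ω) {σ : Ω → ℝ≥0} {L : ℝ≥0}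
    (hσ : IsStoppingTime 𝓕 fun ω => (σ ω : WithTop ℝ≥0)) (hL : ∀ ω, σ ω ≤ L) {f : Ω → ℝ≥0∞}
    (hf : Measurable[hσ.measurableSpace] f) :
    ∫⁻ ω, ENNReal.ofReal (M (σ ω) ω) * f ω ∂P = ∫⁻ ω, ENNReal.ofReal (M L ω) * f ω ∂P := by
  have hle := hσ.measurableSpace_le
  have hi := Martingale.integrable_stopped hM hc hσ hL
  have hm1 : AEMeasurable (fun ω => ENNReal.ofReal (M (σ ω) ω)) P :=
    hi.aestronglyMeasurable.aemeasurable.ennreal_ofReal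
  have hm2 : AEMeasurable (fun ω => ENNReal.ofReal (M L ω)) P :=
    (hM.integrable L).aestronglyMeasurable.aemeasurable.ennreal_ofReal
  have hf' : AEMeasurable f P := (hf.mono hle le_rfl).aemeasurable
  have key : (P.withDensity fun ω => ENNReal.ofReal (M (σ ω) ω)).trim hle =
      (P.withDensity fun ω => ENNReal.ofReal (M L ω)).trim hle := by
    refine @Measure.ext _ hσ.measurableSpace _ _ fun A hA => ?_
    rw [trim_measurableSet_eq hle hA, trim_measurableSet_eq hle hA, withDensity_apply _ (hle _ hA),
      withDensity_apply _ (hle _ hA), ← ofReal_integral_eq_lintegral_ofReal hi.integrableOn,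
      ← ofReal_integral_eq_lintegral_ofReal (hM.integrable L).integrableOn,
      Martingale.setIntegral_stopped hM hc hσ hL hA]
    · exact ae_restrict_of_ae (h0.mono fun ω h => h L)
    · exact ae_restrict_of_ae (h0.mono fun ω h => h _)
  have e1 := lintegral_withDensity_eq_lintegral_mul₀ hm1 hf'
  have e2 := lintegral_withDensity_eq_lintegral_mul₀ hm2 hf'
  simp only [Pi.mul_apply] at e1 e2
  rw [← e1, ← e2, ← lintegral_trim hle hf, ← lintegral_trim hle hf, key]

/-- The minimum with `t` is finite, so the default value of `untopA` at `⊤` never enters. -/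
theorem coe_untopA_min (t : ℝ≥0) (x : WithTop ℝ≥0) :
    (((min (t : WithTop ℝ≥0) x).untopA : ℝ≥0) : WithTop ℝ≥0) = min (t : WithTop ℝ≥0) x := by
  cases x with
  | top => rw [min_eq_left le_top]; rfl
  | coe y => rw [← WithTop.coe_min]; rfl

theorem untopA_min_le (t : ℝ≥0) (x : WithTop ℝ≥0) : (min (t : WithTop ℝ≥0) x).untopA ≤ t := by
  rw [← WithTop.coe_le_coe, coe_untopA_min]
  exact min_le_left _ _

theorem isStoppingTime_untopA_min {τ : Ω → WithTop ℝ≥0} (hτ : IsStoppingTime 𝓕 τ) (t : ℝ≥0) :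
    IsStoppingTime 𝓕 fun ω => (((min (t : WithTop ℝ≥0) (τ ω)).untopA : ℝ≥0) : WithTop ℝ≥0) := by
  simp only [coe_untopA_min]
  exact (isStoppingTime_const 𝓕 t).min hτ

theorem Martingale.stoppedProcess (hM : Martingale M 𝓕 P)
    (hc : ∀ ω, Continuous fun t => M t ω) {τ : Ω → WithTop ℝ≥0} (hτ : IsStoppingTime 𝓕 τ) :
    Martingale (stoppedProcess M τ) 𝓕 P := by
  have hint : ∀ t, Integrable (MeasureTheory.stoppedProcess M τ t) P := fun t =>
    Martingale.integrable_stopped hM hc (isStoppingTime_untopA_min hτ t)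
      fun ω => untopA_min_le t (τ ω)
  refine martingale_of_setIntegral_eq
    (IsStronglyProgressive.stronglyAdapted_stoppedProcess
      (hM.stronglyAdapted.isStronglyProgressive_of_continuous hc) hτ)
    hint fun s t hst A hA => ?_
  have hs := isStoppingTime_untopA_min hτ s
  have ht := isStoppingTime_untopA_min hτ t
  have hsτ : MeasurableSet[𝓕 s] {ω | (s : WithTop ℝ≥0) < τ ω} := hτ.measurableSet_gt s
  -- On `{s < τ}` the sampled time is `s` itself, so events of `𝓕 s` inside it belong to the past of
  -- `min s τ`.
  have hB : MeasurableSet[hs.measurableSpace] (A ∩ {ω | (s : WithTop ℝ≥0) < τ ω}) := by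
    refine ⟨(le_iSup 𝓕 s) _ (hA.inter hsτ), fun i => ?_⟩
    rcases lt_or_ge i s with hi | hi
    · refine (congrArg (MeasurableSet[𝓕 i]) (?_ : _ = (∅ : Set Ω))).mpr
        (@MeasurableSet.empty _ (𝓕 i))
      ext ω
      simp only [Set.mem_inter_iff, Set.mem_ofPred_eq, Set.mem_empty_iff_false, iff_false, not_and,
        coe_untopA_min]
      rintro ⟨_, h⟩ h'
      rw [min_eq_left h.le, WithTop.coe_le_coe] at h'
      exact absurd hi h'.not_gt
    · exact (𝓕.mono hi _ (hA.inter hsτ)).inter (hs i)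
  have hB' : MeasurableSet[ht.measurableSpace] (A ∩ {ω | (s : WithTop ℝ≥0) < τ ω}) := by
    refine hs.measurableSpace_mono ht (fun ω => ?_) _ hB
    simp only [coe_untopA_min]
    exact min_le_min_right _ (WithTop.coe_le_coe.2 hst)
  have hsplit := fun u => integral_inter_add_sdiff (μ := P) (s := A) (𝓕.le s _ hsτ)
    (hint u).integrableOn
  rw [← hsplit s, ← hsplit t]
  congr 1
  -- Both sampled times are at most `t`, so both integrals equal that of `M t`. On the complement of
  -- `{s < τ}` the two stopped values coincide.
  · refine (Martingale.setIntegral_stopped hM hc hs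
      (fun ω => (untopA_min_le s (τ ω)).trans hst) hB).trans ?_
    exact (Martingale.setIntegral_stopped hM hc ht (fun ω => untopA_min_le t (τ ω)) hB').symm
  · refine setIntegral_congr_fun ((𝓕.le s _ hA).diff (𝓕.le s _ hsτ)) fun ω hω => ?_
    have h : τ ω ≤ s := not_lt.1 hω.2
    simp only [MeasureTheory.stoppedProcess, min_eq_right h,
      min_eq_right (h.trans (WithTop.coe_le_coe.2 hst))]

end OptionalSampling

end MonotoneStopping

namespace MonotoneStopping

variable {Ω : Type*} {m0 : MeasurableSpace Ω}

/-! ### Products of bounded independent martingales. -/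

section IndependentMartingales

variable {𝓕 : Filtration ℝ≥0 m0} {P : Measure Ω} [IsProbabilityMeasure P] {M N : ℝ≥0 → Ω → ℝ}

theorem Martingale.integral_mul_sub_eq_zero (hM : Martingale M 𝓕 P) {s t : ℝ≥0} (hst : s ≤ t)
    {Z : Ω → ℝ} (hZ : StronglyMeasurable[𝓕 s] Z)
    (hint : Integrable (fun ω => Z ω * (M t ω - M s ω)) P) :
    ∫ ω, Z ω * (M t ω - M s ω) ∂P = 0 := by
  have h1 : P[Z * (M t - M s) | 𝓕 s] =ᵐ[P] Z * P[M t - M s | 𝓕 s] :=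
    condExp_mul_of_stronglyMeasurable_left hZ hint ((hM.integrable t).sub (hM.integrable s))
  have h2 : P[M t - M s | 𝓕 s] =ᵐ[P] 0 := by
    refine (condExp_sub (hM.integrable t) (hM.integrable s) _).trans ?_
    filter_upwards [hM.condExp_ae_eq hst, hM.condExp_ae_eq (le_refl s)] with ω h h'
    simp [h, h']
  rw [← integral_condExp (𝓕.le s)]
  refine integral_eq_zero_of_ae ?_
  filter_upwards [h1, h2] with ω h h'
  refine h.trans ?_
  simp [h']

omit [IsProbabilityMeasure P] in
theorem integral_mul_of_indep {G H : MeasurableSpace Ω} (hG : G ≤ m0) (hH : H ≤ m0)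
    (hind : Indep G H P) {f g : Ω → ℝ} (hf : StronglyMeasurable[G] f)
    (hg : StronglyMeasurable[H] g) :
    ∫ ω, f ω * g ω ∂P = (∫ ω, f ω ∂P) * ∫ ω, g ω ∂P := by
  have : IndepFun f g P := by
    rw [IndepFun_iff_Indep]
    exact indep_of_indep_of_le_left (indep_of_indep_of_le_right hind hg.measurable.comap_le)
      hf.measurable.comap_le
  exact this.integral_fun_mul_eq_mul_integral (hf.mono hG).aestronglyMeasurable
    (hg.mono hH).aestronglyMeasurable

/-- A process all of whose values are measurable and bounded by `C`. -/
structure BoundedBy (m : MeasurableSpace Ω) (C : ℝ) (M : ℝ≥0 → Ω → ℝ) : Prop where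
  measurable : ∀ t, Measurable[m] (M t)
  bound : ∀ t ω, |M t ω| ≤ C

theorem integrable_of_bound {f : Ω → ℝ} (hf : Measurable f) {C : ℝ} (h : ∀ ω, |f ω| ≤ C) :
    Integrable f P :=
  Integrable.of_bound hf.aestronglyMeasurable C (ae_of_all _ h)

theorem Martingale.integral_sub_sq (hM : Martingale M 𝓕 P) {C : ℝ} (hb : BoundedBy m0 C M)
    {s t : ℝ≥0} (hst : s ≤ t) :
    ∫ ω, (M t ω - M s ω) ^ 2 ∂P = ∫ ω, M t ω ^ 2 ∂P - ∫ ω, M s ω ^ 2 ∂P := by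
  have hm := hb.measurable
  have hbd := hb.bound
  have i1 : ∀ u, Integrable (fun ω => M u ω ^ 2) P := fun u =>
    integrable_of_bound (by fun_prop) (C := C ^ 2) fun ω => by
      rw [abs_pow]; exact pow_le_pow_left₀ (abs_nonneg _) (hbd u ω) 2
  have i2 : Integrable (fun ω => M s ω * (M t ω - M s ω)) P :=
    integrable_of_bound (by fun_prop) (C := C * (C + C)) fun ω => by
      rw [abs_mul]
      exact mul_le_mul (hbd s ω) ((abs_sub _ _).trans (add_le_add (hbd t ω) (hbd s ω)))
        (abs_nonneg _) ((abs_nonneg _).trans (hbd s ω))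
  have h := Martingale.integral_mul_sub_eq_zero hM hst (hM.stronglyAdapted s) i2
  have e : ∀ ω, (M t ω - M s ω) ^ 2 = M t ω ^ 2 - M s ω ^ 2 - 2 * (M s ω * (M t ω - M s ω)) :=
    fun ω => by ring
  simp_rw [e]
  have i3 : Integrable (fun ω => M t ω ^ 2 - M s ω ^ 2) P := (i1 t).sub (i1 s)
  rw [integral_sub i3 (i2.const_mul 2), integral_sub (i1 t) (i1 s), integral_const_mul, h]
  ring

theorem BoundedBy.abs_sub_le {C : ℝ} (hb : BoundedBy m0 C M) (s t : ℝ≥0) (ω : Ω) :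
    |M t ω - M s ω| ≤ C + C :=
  (abs_sub _ _).trans (add_le_add (hb.bound t ω) (hb.bound s ω))

/-- Discrete integration by parts: `Δ(MN) = M ΔN + N ΔM + ΔM ΔN`, and the first two terms integrate
to zero over an event known at the start. -/
theorem Martingale.setIntegral_mul_sub (hM : Martingale M 𝓕 P) (hN : Martingale N 𝓕 P) {C : ℝ}
    (hMb : BoundedBy m0 C M) (hNb : BoundedBy m0 C N) {p : ℕ → ℝ≥0} (hp : Monotone p) {A : Set Ω}
    (hA : MeasurableSet[𝓕 (p 0)] A) (n : ℕ) :
    ∫ ω in A, M (p n) ω * N (p n) ω ∂P - ∫ ω in A, M (p 0) ω * N (p 0) ω ∂P =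
      ∫ ω in A, ∑ k ∈ Finset.range n,
        (M (p (k + 1)) ω - M (p k) ω) * (N (p (k + 1)) ω - N (p k) ω) ∂P := by
  have hm := hMb.measurable
  have hn := hNb.measurable
  have bd : ∀ {x y a b : ℝ}, |x| ≤ a → |y| ≤ b → |x * y| ≤ a * b := fun {x y a b} hx hy => by
    rw [abs_mul]; exact mul_le_mul hx hy (abs_nonneg _) ((abs_nonneg _).trans hx)
  have i0 : ∀ u v, Integrable (fun ω => M u ω * N v ω) P := fun u v =>
    integrable_of_bound (by fun_prop) (C := C * C) fun ω => bd (hMb.bound _ _) (hNb.bound _ _)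
  have i1 : ∀ k, Integrable (fun ω =>
      (M (p (k + 1)) ω - M (p k) ω) * (N (p (k + 1)) ω - N (p k) ω)) P := fun k =>
    integrable_of_bound (by fun_prop) (C := (C + C) * (C + C)) fun ω =>
      bd (hMb.abs_sub_le _ _ _) (hNb.abs_sub_le _ _ _)
  have hA0 := 𝓕.le _ _ hA
  have z : ∀ {K L : ℝ≥0 → Ω → ℝ}, Martingale K 𝓕 P → Martingale L 𝓕 P → BoundedBy m0 C K →
      BoundedBy m0 C L → ∀ k, ∫ ω in A, K (p k) ω * (L (p (k + 1)) ω - L (p k) ω) ∂P = 0 := by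
    intro K L hK hL hKb hLb k
    have hk := hKb.measurable
    have hl := hLb.measurable
    have hAk : MeasurableSet[𝓕 (p k)] A := 𝓕.mono (hp (Nat.zero_le k)) _ hA
    have := Martingale.integral_mul_sub_eq_zero hL (hp (Nat.le_succ k))
      (Z := A.indicator (K (p k))) ((hK.stronglyAdapted _).indicator hAk) ?_
    · rw [← integral_indicator hA0, ← this]
      congr 1 with ω
      by_cases h : ω ∈ A <;> simp [h]
    · have : Integrable (A.indicator fun ω => K (p k) ω * (L (p (k + 1)) ω - L (p k) ω)) P :=
        (integrable_of_bound (by fun_prop) (C := C * (C + C)) fun ω =>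
          bd (hKb.bound _ _) (hLb.abs_sub_le _ _ _)).indicator hA0
      refine this.congr (ae_of_all _ fun ω => ?_)
      by_cases h : ω ∈ A <;> simp [h]
  induction n with
  | zero => simp
  | succ n ih =>
    simp_rw [Finset.sum_range_succ]
    rw [integral_add (integrable_finsetSum _ fun k _ => i1 k).integrableOn (i1 n).integrableOn,
      ← ih]
    have e : ∀ ω, M (p (n + 1)) ω * N (p (n + 1)) ω =
        M (p n) ω * N (p n) ω + (M (p n) ω * (N (p (n + 1)) ω - N (p n) ω) +
          (N (p n) ω * (M (p (n + 1)) ω - M (p n) ω) +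
          (M (p (n + 1)) ω - M (p n) ω) * (N (p (n + 1)) ω - N (p n) ω))) := fun ω => by ring
    have j1 : Integrable (fun ω => M (p n) ω * (N (p (n + 1)) ω - N (p n) ω)) P :=
      integrable_of_bound (by fun_prop) (C := C * (C + C)) fun ω =>
        bd (hMb.bound _ _) (hNb.abs_sub_le _ _ _)
    have j2 : Integrable (fun ω => N (p n) ω * (M (p (n + 1)) ω - M (p n) ω)) P :=
      integrable_of_bound (by fun_prop) (C := C * (C + C)) fun ω =>
        bd (hNb.bound _ _) (hMb.abs_sub_le _ _ _)
    simp_rw [e]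
    have j3 : Integrable (fun ω => N (p n) ω * (M (p (n + 1)) ω - M (p n) ω) +
        (M (p (n + 1)) ω - M (p n) ω) * (N (p (n + 1)) ω - N (p n) ω)) P := j2.add (i1 n)
    have j4 : Integrable (fun ω => M (p n) ω * (N (p (n + 1)) ω - N (p n) ω) +
        (N (p n) ω * (M (p (n + 1)) ω - M (p n) ω) +
        (M (p (n + 1)) ω - M (p n) ω) * (N (p (n + 1)) ω - N (p n) ω))) P := j1.add j3
    rw [integral_add (i0 _ _).integrableOn j4.integrableOn,
      integral_add j1.integrableOn j3.integrableOn,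
      integral_add j2.integrableOn (i1 n).integrableOn, z hM hN hMb hNb, z hN hM hNb hMb]
    ring

/-- Independence splits each term of the expanded square into an `M`-factor and an `N`-factor; off
the diagonal the `M`-factor vanishes by orthogonality of martingale increments. -/
theorem Martingale.integral_sum_mul_sub_sq (hM : Martingale M 𝓕 P) {C : ℝ}
    (hMb : BoundedBy m0 C M) (hNb : BoundedBy m0 C N) {G H : MeasurableSpace Ω} (hG : G ≤ m0)
    (hH : H ≤ m0) (hind : Indep G H P) (hMG : ∀ t, StronglyMeasurable[G] (M t))
    (hNH : ∀ t, StronglyMeasurable[H] (N t)) {p : ℕ → ℝ≥0} (hp : Monotone p) (n : ℕ) :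
    ∫ ω, (∑ k ∈ Finset.range n,
        (M (p (k + 1)) ω - M (p k) ω) * (N (p (k + 1)) ω - N (p k) ω)) ^ 2 ∂P =
      ∑ k ∈ Finset.range n, (∫ ω, (M (p (k + 1)) ω - M (p k) ω) ^ 2 ∂P) *
        ∫ ω, (N (p (k + 1)) ω - N (p k) ω) ^ 2 ∂P := by
  have hm := hMb.measurable
  have hn := hNb.measurable
  have bd : ∀ {x y a b : ℝ}, |x| ≤ a → |y| ≤ b → |x * y| ≤ a * b := fun {x y a b} hx hy => by
    rw [abs_mul]; exact mul_le_mul hx hy (abs_nonneg _) ((abs_nonneg _).trans hx)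
  have i1 : ∀ k l, Integrable (fun ω =>
      ((M (p (k + 1)) ω - M (p k) ω) * (N (p (k + 1)) ω - N (p k) ω)) *
      ((M (p (l + 1)) ω - M (p l) ω) * (N (p (l + 1)) ω - N (p l) ω))) P := fun k l =>
    integrable_of_bound (by fun_prop) (C := (C + C) * (C + C) * ((C + C) * (C + C))) fun ω =>
      bd (bd (hMb.abs_sub_le _ _ _) (hNb.abs_sub_le _ _ _))
        (bd (hMb.abs_sub_le _ _ _) (hNb.abs_sub_le _ _ _))
  have hfac : ∀ k l, ∫ ω, ((M (p (k + 1)) ω - M (p k) ω) * (N (p (k + 1)) ω - N (p k) ω)) *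
      ((M (p (l + 1)) ω - M (p l) ω) * (N (p (l + 1)) ω - N (p l) ω)) ∂P =
      (∫ ω, (M (p (k + 1)) ω - M (p k) ω) * (M (p (l + 1)) ω - M (p l) ω) ∂P) *
      ∫ ω, (N (p (k + 1)) ω - N (p k) ω) * (N (p (l + 1)) ω - N (p l) ω) ∂P := by
    intro k l
    refine Eq.trans ?_ (integral_mul_of_indep hG hH hind
      (((hMG _).sub (hMG _)).mul ((hMG _).sub (hMG _)))
      (((hNH _).sub (hNH _)).mul ((hNH _).sub (hNH _))))
    refine integral_congr_ae (ae_of_all _ fun ω => ?_)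
    exact mul_mul_mul_comm _ _ _ _
  have horth : ∀ k l, k < l →
      ∫ ω, (M (p (k + 1)) ω - M (p k) ω) * (M (p (l + 1)) ω - M (p l) ω) ∂P = 0 := by
    intro k l hkl
    refine Martingale.integral_mul_sub_eq_zero hM (hp (Nat.le_succ l))
      (Z := fun ω => M (p (k + 1)) ω - M (p k) ω) ?_ ?_
    · exact ((hM.stronglyAdapted _).mono (𝓕.mono (hp hkl))).sub
        ((hM.stronglyAdapted _).mono (𝓕.mono (hp hkl.le)))
    · exact integrable_of_bound (by fun_prop) (C := (C + C) * (C + C)) fun ω =>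
        bd (hMb.abs_sub_le _ _ _) (hMb.abs_sub_le _ _ _)
  simp_rw [pow_two (Finset.sum _ _), Finset.sum_mul_sum]
  rw [integral_finsetSum _ fun k _ => integrable_finsetSum _ fun l _ => i1 k l]
  refine Finset.sum_congr rfl fun k hk => ?_
  rw [integral_finsetSum _ fun l _ => i1 k l, Finset.sum_eq_single_of_mem k hk]
  · rw [hfac]
    simp_rw [pow_two]
  · intro l _ hlk
    rw [hfac]
    rcases lt_or_gt_of_ne hlk with h | h
    · simp_rw [mul_comm (M (p (k + 1)) _ - M (p k) _)]
      rw [horth l k h, zero_mul]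
    · rw [horth k l h, zero_mul]

theorem BoundedBy.continuous_integral_sq {C : ℝ} (hb : BoundedBy m0 C M)
    (hc : ∀ ω, Continuous fun t => M t ω) : Continuous fun t => ∫ ω, M t ω ^ 2 ∂P := by
  have hm := hb.measurable
  refine continuous_of_dominated (bound := fun _ => C ^ 2) (fun t => by fun_prop) (fun t => ?_)
    (integrable_const _) (ae_of_all _ fun ω => (hc ω).pow 2)
  refine ae_of_all _ fun ω => ?_
  rw [Real.norm_eq_abs, abs_pow]
  exact pow_le_pow_left₀ (abs_nonneg _) (hb.bound t ω) 2

/-- This is nonnegativity of the variance of `1_A f`. -/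
theorem sq_setIntegral_le {f : Ω → ℝ} (hf : Measurable f) {C : ℝ} (hb : ∀ ω, |f ω| ≤ C)
    {A : Set Ω} (hA : MeasurableSet A) : (∫ ω in A, f ω ∂P) ^ 2 ≤ ∫ ω, f ω ^ 2 ∂P := by
  have hb' : ∀ ω, |A.indicator f ω| ≤ C := fun ω => by
    by_cases h : ω ∈ A
    · simpa [h] using hb ω
    · simpa [h] using (abs_nonneg _).trans (hb ω)
  have hLp : MemLp (A.indicator f) 2 P :=
    MemLp.of_bound (hf.indicator hA).aestronglyMeasurable C (ae_of_all _ hb')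
  have h := variance_nonneg (A.indicator f) P
  rw [variance_eq_sub hLp, integral_indicator hA] at h
  refine (sub_nonneg.1 h).trans (integral_mono hLp.integrable_sq ?_ fun ω => ?_)
  · exact integrable_of_bound (by fun_prop) (C := C ^ 2) fun ω => by
      rw [abs_pow]; exact pow_le_pow_left₀ (abs_nonneg _) (hb ω) 2
  · by_cases h : ω ∈ A
    · simp [h]
    · simpa [h] using sq_nonneg (f ω)

/-- `A` need not be independent of either process, so it is removed by `sq_setIntegral_le`; what
remains is the second moment of the discrete covariation, which is small on fine partitions. -/
theorem Martingale.setIntegral_mul_eq_of_bounded (hM : Martingale M 𝓕 P) (hN : Martingale N 𝓕 P)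
    (hcM : ∀ ω, Continuous fun t => M t ω) {C : ℝ}
    (hMb : BoundedBy m0 C M) (hNb : BoundedBy m0 C N) {G H : MeasurableSpace Ω} (hG : G ≤ m0)
    (hH : H ≤ m0) (hind : Indep G H P) (hMG : ∀ t, StronglyMeasurable[G] (M t))
    (hNH : ∀ t, StronglyMeasurable[H] (N t)) {s t : ℝ≥0} (hst : s ≤ t) {A : Set Ω}
    (hA : MeasurableSet[𝓕 s] A) :
    ∫ ω in A, M s ω * N s ω ∂P = ∫ ω in A, M t ω * N t ω ∂P := by
  have hm := hMb.measurable
  have hn := hNb.measurable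
  set D := ∫ ω in A, M t ω * N t ω ∂P - ∫ ω in A, M s ω * N s ω ∂P with hD
  suffices h : ∀ ε > 0, D ^ 2 ≤ ε * C ^ 2 by
    have : D ^ 2 ≤ 0 := by
      have hl : Tendsto (fun ε : ℝ => ε * C ^ 2) (𝓝[>] 0) (𝓝 (0 * C ^ 2)) :=
        (tendsto_id.mono_left nhdsWithin_le_nhds).mul_const _
      rw [zero_mul] at hl
      exact ge_of_tendsto hl (eventually_mem_nhdsWithin.mono fun ε hε => h ε hε)
    have : D = 0 := by nlinarith [sq_nonneg D]
    linarith
  intro ε hε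
  have huc := (isCompact_Icc (a := s) (b := t)).uniformContinuousOn_of_continuous
    (hMb.continuous_integral_sq (P := P) hcM).continuousOn
  obtain ⟨δ, hδ, huc⟩ := Metric.uniformContinuousOn_iff.1 huc ε hε
  obtain ⟨h, rfl⟩ := exists_add_of_le hst
  -- With this `n` the mesh `h / (n + 1)` is below `δ`, so `E M²` changes by less than `ε` over each
  -- cell.
  obtain ⟨n, hn'⟩ := exists_nat_gt ((h : ℝ) / δ)
  set p : ℕ → ℝ≥0 := fun k => s + k * (h / (n + 1)) with hpdef
  have hp : Monotone p := fun k l hkl => by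
    simp only [hpdef]; gcongr
  have hp0 : p 0 = s := by simp [hpdef]
  have hpn : p (n + 1) = s + h := by
    simp only [hpdef]; push_cast; rw [mul_div_cancel₀ _ (by positivity)]
  have hmem : ∀ k ≤ n + 1, p k ∈ Set.Icc s (s + h) := fun k hk =>
    ⟨hp0 ▸ hp (Nat.zero_le k), hpn ▸ hp hk⟩
  have hdist : ∀ k, dist (p (k + 1)) (p k) < δ := fun k => by
    rw [NNReal.dist_eq]
    simp only [hpdef]
    push_cast
    have h0 : (0 : ℝ) < n + 1 := by positivity
    have : (h : ℝ) / (n + 1) < δ := by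
      rw [div_lt_iff₀ h0, mul_comm]
      rw [div_lt_iff₀ hδ] at hn'
      nlinarith
    rw [show ((s : ℝ) + (k + 1) * (h / (n + 1))) - (s + k * (h / (n + 1))) = h / (n + 1) by ring,
      abs_of_nonneg (by positivity)]
    exact this
  have hA0 := 𝓕.le _ _ hA
  have e1 := Martingale.setIntegral_mul_sub hM hN hMb hNb hp (A := A) (hp0 ▸ hA) (n + 1)
  rw [hp0, hpn, ← hD] at e1
  have bd : ∀ {x y a b : ℝ}, |x| ≤ a → |y| ≤ b → |x * y| ≤ a * b := fun {x y a b} hx hy => by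
    rw [abs_mul]; exact mul_le_mul hx hy (abs_nonneg _) ((abs_nonneg _).trans hx)
  rw [e1]
  refine (sq_setIntegral_le (by fun_prop)
    (C := ∑ k ∈ Finset.range (n + 1), (C + C) * (C + C)) (fun ω => ?_) hA0).trans ?_
  · exact (Finset.abs_sum_le_sum_abs _ _).trans (Finset.sum_le_sum fun k _ =>
      bd (hMb.abs_sub_le _ _ _) (hNb.abs_sub_le _ _ _))
  rw [Martingale.integral_sum_mul_sub_sq hM hMb hNb hG hH hind hMG hNH hp]
  -- Each `E(ΔM)²` is an increment of `E M²`, hence at most `ε`, while the `E(ΔN)²` telescope to at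
  -- most `C²`.
  calc _ ≤ ∑ k ∈ Finset.range (n + 1),
        ε * (∫ ω, N (p (k + 1)) ω ^ 2 ∂P - ∫ ω, N (p k) ω ^ 2 ∂P) := by
        refine Finset.sum_le_sum fun k hk => ?_
        rw [← Martingale.integral_sub_sq hN hNb (hp (Nat.le_succ k))]
        refine mul_le_mul_of_nonneg_right ?_ (integral_nonneg fun ω => sq_nonneg _)
        rw [Martingale.integral_sub_sq hM hMb (hp (Nat.le_succ k))]
        have hk' : k + 1 ≤ n + 1 := Finset.mem_range.1 hk
        exact (le_abs_self _).trans (huc _ (hmem _ hk') _ (hmem _ (Nat.le_of_succ_le hk'))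
          (hdist k)).le
    _ = ε * (∫ ω, N (p (n + 1)) ω ^ 2 ∂P - ∫ ω, N (p 0) ω ^ 2 ∂P) := by
        rw [← Finset.mul_sum, Finset.sum_range_sub (fun k => ∫ ω, N (p k) ω ^ 2 ∂P)]
    _ ≤ ε * C ^ 2 := by
        refine mul_le_mul_of_nonneg_left ?_ hε.le
        refine (sub_le_self _ (integral_nonneg fun ω => sq_nonneg _)).trans ?_
        refine (integral_mono_of_nonneg (ae_of_all _ fun ω => sq_nonneg _)
          (integrable_const (C ^ 2)) (ae_of_all _ fun ω => ?_)).trans (by simp)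
        rw [← sq_abs]
        exact pow_le_pow_left₀ (abs_nonneg _) (hNb.bound _ ω) 2

end IndependentMartingales

end MonotoneStopping

namespace MonotoneStopping

variable {Ω : Type*} {m0 : MeasurableSpace Ω}

/-! ### Removing the boundedness by truncation. -/

section Truncation

variable {𝓕 : Filtration ℝ≥0 m0} {P : Measure Ω} [IsProbabilityMeasure P] {M N : ℝ≥0 → Ω → ℝ}

/-- Before the hitting time the path avoids `S`, and continuity extends this to the hitting time
itself. At `t = 0` there are no earlier times, hence the extra hypothesis. -/
theorem mem_closure_compl_of_le_hittingAfter {Z : ℝ≥0 → Ω → ℝ} {ω : Ω}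
    (hc : Continuous fun t => Z t ω) {S : Set ℝ} {t : ℝ≥0}
    (ht : (t : WithTop ℝ≥0) ≤ hittingAfter Z S 0 ω) (h0 : 0 < t ∨ Z 0 ω ∉ S) :
    Z t ω ∈ closure Sᶜ := by
  rcases eq_or_ne t 0 with rfl | ht0
  · exact subset_closure (h0.resolve_left (lt_irrefl _))
  · have hcl : t ∈ closure (Set.Iio t) := by
      rw [closure_Iio' ⟨0, pos_iff_ne_zero.2 ht0⟩]
      exact Set.mem_Iic.2 le_rfl
    exact map_mem_closure (f := fun t => Z t ω) hc hcl fun u hu =>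
      notMem_closure_of_lt_hittingAfter ((WithTop.coe_lt_coe.2 hu).trans_le ht)

theorem continuous_untopA_min (x : WithTop ℝ≥0) :
    Continuous fun t : ℝ≥0 => (min (t : WithTop ℝ≥0) x).untopA := by
  cases x with
  | top =>
    have : (fun t : ℝ≥0 => (min (t : WithTop ℝ≥0) ⊤).untopA) = id := by
      ext t; rw [min_eq_left le_top]; rfl
    rw [this]
    exact continuous_id
  | coe y =>
    have : (fun t : ℝ≥0 => (min (t : WithTop ℝ≥0) y).untopA) = fun t => min t y := by
      ext t; rw [← WithTop.coe_min]; rfl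
    rw [this]
    fun_prop

theorem isRightContinuous_const {G : MeasurableSpace Ω} (hG : G ≤ m0) :
    (Filtration.const ℝ≥0 G hG).IsRightContinuous where
  RC i := by
    rw [Filtration.rightCont_eq]
    obtain ⟨j, hj⟩ := exists_gt i
    exact iInf₂_le j hj

theorem Martingale.indicator (hM : Martingale M 𝓕 P) {A : Set Ω} (hA : MeasurableSet[𝓕 0] A) :
    Martingale (fun t => A.indicator (M t)) 𝓕 P := by
  have hA' : ∀ t, MeasurableSet[𝓕 t] A := fun t => 𝓕.mono zero_le _ hA
  refine martingale_of_setIntegral_eq (fun t => (hM.stronglyAdapted t).indicator (hA' t))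
    (fun t => (hM.integrable t).indicator (𝓕.le 0 _ hA)) fun s t hst B hB => ?_
  rw [setIntegral_indicator (𝓕.le 0 _ hA), setIntegral_indicator (𝓕.le 0 _ hA)]
  exact hM.setIntegral_eq hst (hB.inter (hA' s))

/-- The first time at which `|M|` exceeds `n`. -/
noncomputable def exitTime (M : ℝ≥0 → Ω → ℝ) (n : ℕ) : Ω → WithTop ℝ≥0 :=
  hittingAfter M {x | (n : ℝ) < |x|} 0

/-- The process `M` stopped when `|M|` exceeds `n`, and `0` if `|M 0| > n`. -/
noncomputable def truncation (M : ℝ≥0 → Ω → ℝ) (n : ℕ) (t : ℝ≥0) : Ω → ℝ :=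
  {ω | |M 0 ω| ≤ n}.indicator (stoppedProcess M (exitTime M n) t)

theorem isOpen_lt_abs (n : ℕ) : IsOpen {x : ℝ | (n : ℝ) < |x|} :=
  isOpen_lt continuous_const continuous_abs

theorem isStoppingTime_exitTime [𝓕.IsRightContinuous] (hM : StronglyAdapted 𝓕 M)
    (hc : ∀ ω, Continuous fun t => M t ω) (n : ℕ) : IsStoppingTime 𝓕 (exitTime M n) :=
  isStoppingTime_hittingAfter_of_isOpen hM hc (isOpen_lt_abs n)

theorem measurableSet_abs_zero_le (hM : StronglyAdapted 𝓕 M) (n : ℕ) :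
    MeasurableSet[𝓕 0] {ω | |M 0 ω| ≤ n} :=
  (hM 0).measurable (measurableSet_le measurable_norm measurable_const :
    MeasurableSet {x : ℝ | ‖x‖ ≤ n})

theorem abs_truncation_le (hc : ∀ ω, Continuous fun t => M t ω) (n : ℕ) (t : ℝ≥0) (ω : Ω) :
    |truncation M n t ω| ≤ n := by
  by_cases h : |M 0 ω| ≤ n
  · rw [truncation, Set.indicator_of_mem (by exact h), stoppedProcess]
    have := mem_closure_compl_of_le_hittingAfter (S := {x : ℝ | (n : ℝ) < |x|}) (hc ω)
      (t := (min (t : WithTop ℝ≥0) (exitTime M n ω)).untopA)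
      ((coe_untopA_min t _).trans_le (min_le_right _ _)) (Or.inr (not_lt.2 h))
    rw [(isOpen_lt_abs n).isClosed_compl.closure_eq] at this
    exact not_lt.1 this
  · rw [truncation, Set.indicator_of_notMem (by exact h)]
    simp

theorem stronglyAdapted_truncation [𝓕.IsRightContinuous] (hM : StronglyAdapted 𝓕 M)
    (hc : ∀ ω, Continuous fun t => M t ω) (n : ℕ) : StronglyAdapted 𝓕 (truncation M n) := fun t =>
  (IsStronglyProgressive.stronglyAdapted_stoppedProcess (hM.isStronglyProgressive_of_continuous hc)
    (isStoppingTime_exitTime hM hc n) t).indicator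
    (𝓕.mono zero_le _ (measurableSet_abs_zero_le hM n))

theorem boundedBy_truncation [𝓕.IsRightContinuous] (hM : StronglyAdapted 𝓕 M)
    (hc : ∀ ω, Continuous fun t => M t ω) (n : ℕ) : BoundedBy m0 n (truncation M n) :=
  ⟨fun t => ((stronglyAdapted_truncation hM hc n t).mono (𝓕.le t)).measurable,
    abs_truncation_le hc n⟩

theorem continuous_stoppedProcess (hc : ∀ ω, Continuous fun t => M t ω) (τ : Ω → WithTop ℝ≥0)
    (ω : Ω) : Continuous fun t => stoppedProcess M τ t ω :=
  (hc ω).comp (continuous_untopA_min _)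

theorem continuous_truncation (hc : ∀ ω, Continuous fun t => M t ω) (n : ℕ) (ω : Ω) :
    Continuous fun t => truncation M n t ω := by
  by_cases h : |M 0 ω| ≤ n
  · simp only [truncation, Set.indicator_of_mem (show ω ∈ {ω | |M 0 ω| ≤ n} from h)]
    exact continuous_stoppedProcess hc _ ω
  · simp only [truncation, Set.indicator_of_notMem (show ω ∉ {ω | |M 0 ω| ≤ n} from h)]
    exact continuous_const

theorem Martingale.truncation [𝓕.IsRightContinuous] (hM : Martingale M 𝓕 P)
    (hc : ∀ ω, Continuous fun t => M t ω) (n : ℕ) : Martingale (truncation M n) 𝓕 P :=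
  Martingale.indicator (Martingale.stoppedProcess hM hc
    (isStoppingTime_exitTime hM.stronglyAdapted hc n))
    (measurableSet_abs_zero_le hM.stronglyAdapted n)

/-- Adaptedness to the constant filtration at `G` is measurability in `G`. So truncating uses only
information of the process itself, and truncations of independent processes stay independent. -/
theorem stronglyMeasurable_truncation {G : MeasurableSpace Ω}
    (hM : ∀ t, StronglyMeasurable[G] (M t))
    (hc : ∀ ω, Continuous fun t => M t ω) (n : ℕ) (t : ℝ≥0) :
    StronglyMeasurable[G] (MonotoneStopping.truncation M n t) := by
  have := isRightContinuous_const (le_refl G)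
  exact stronglyAdapted_truncation (𝓕 := Filtration.const ℝ≥0 G le_rfl) hM hc n t

theorem eventually_lt_exitTime {ω : Ω} (hc : Continuous fun t => M t ω) (t : ℝ≥0) :
    ∀ᶠ n in atTop, (t : WithTop ℝ≥0) ≤ exitTime M n ω ∧ |M 0 ω| ≤ n := by
  obtain ⟨C, hC⟩ := (isCompact_Icc (a := 0) (b := t)).exists_bound_of_continuousOn hc.continuousOn
  filter_upwards [eventually_ge_atTop ⌈C⌉₊] with n hn
  have hCn : C ≤ n := Nat.ceil_le.1 hn
  refine ⟨not_lt.1 fun h => ?_, (hC 0 ⟨le_rfl, zero_le⟩).trans hCn⟩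
  obtain ⟨s, hs, hsn⟩ := hittingAfter_lt_iff.1 h
  exact absurd ((hC s ⟨hs.1, hs.2.le⟩).trans hCn) (not_le.2 hsn)

/-- The stopped values at `t` are conditional expectations of `M t`, hence uniformly integrable, and
are eventually equal to `M t` on every path. The event `|M 0| > n` costs at most the integral of `|M
t|` over it, which tends to zero. -/
theorem tendsto_integral_abs_truncation_sub [𝓕.IsRightContinuous] (hM : Martingale M 𝓕 P)
    (hc : ∀ ω, Continuous fun t => M t ω) (t : ℝ≥0) :
    Tendsto (fun n => ∫ ω, |MonotoneStopping.truncation M n t ω - M t ω| ∂P) atTop (𝓝 0) := by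
  have hst := fun n => isStoppingTime_untopA_min (isStoppingTime_exitTime hM.stronglyAdapted hc n) t
  have hce := fun n => Martingale.stoppedValue_coe_ae_eq_condExp hM hc (hst n)
    fun ω => untopA_min_le t (exitTime M n ω)
  have hint := fun n => (Martingale.stoppedProcess hM hc
    (isStoppingTime_exitTime hM.stronglyAdapted hc n)).integrable t
  have hui : UniformIntegrable (fun n => MeasureTheory.stoppedProcess M (exitTime M n) t) 1 P :=
    ((hM.integrable t).uniformIntegrable_condExp fun n => (hst n).measurableSpace_le).ae_eq
      fun n => (hce n).symm
  have hlim : ∀ᵐ ω ∂P, Tendsto (fun n => MeasureTheory.stoppedProcess M (exitTime M n) t ω) atTop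
      (𝓝 (M t ω)) := ae_of_all _ fun ω => by
    refine tendsto_const_nhds.congr' ?_
    filter_upwards [eventually_lt_exitTime (hc ω) t] with n hn
    exact (stoppedProcess_eq_of_le hn.1).symm
  have h1 := tendsto_Lp_finite_of_tendsto_ae (μ := P) le_rfl ENNReal.one_ne_top
    (fun n => (hint n).aestronglyMeasurable) (memLp_one_iff_integrable.2 (hM.integrable t))
    hui.unifIntegrable hlim
  have h1' : Tendsto
      (fun n => ∫ ω, |(MeasureTheory.stoppedProcess M (exitTime M n) t) ω - M t ω| ∂P)
      atTop (𝓝 0) := by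
    have := (ENNReal.tendsto_toReal ENNReal.zero_ne_top).comp h1
    refine (by simpa using this : Tendsto _ atTop (𝓝 (0 : ℝ))).congr fun n => ?_
    simp only [Function.comp_apply]
    rw [eLpNorm_one_eq_lintegral_enorm, ← integral_norm_eq_lintegral_enorm
      ((hint n).sub (hM.integrable t)).aestronglyMeasurable]
    rfl
  have hB := fun n => 𝓕.le 0 _ (measurableSet_abs_zero_le hM.stronglyAdapted n)
  have h2 : Tendsto (fun n : ℕ => ∫ ω, {ω | |M 0 ω| ≤ n}ᶜ.indicator (fun ω => |M t ω|) ω ∂P) atTop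
      (𝓝 0) := by
    rw [← integral_zero Ω ℝ (μ := P)]
    refine tendsto_integral_of_dominated_convergence (fun ω => |M t ω|)
      (fun n => ((hM.integrable t).abs.indicator (hB n).compl).aestronglyMeasurable)
      (hM.integrable t).abs (fun n => ae_of_all _ fun ω => ?_) (ae_of_all _ fun ω => ?_)
    · exact (norm_indicator_le_norm_self _ _).trans (by simp)
    · refine tendsto_const_nhds.congr' ?_
      filter_upwards [eventually_lt_exitTime (hc ω) t] with n hn
      rw [Set.indicator_of_notMem]
      exact fun h => h hn.2
  refine squeeze_zero (fun n => integral_nonneg fun ω => abs_nonneg _) (fun n => ?_)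
    (by simpa using h1'.add h2)
  have i1 : Integrable (fun ω => |(MeasureTheory.stoppedProcess M (exitTime M n) t) ω - M t ω|) P :=
    ((hint n).sub (hM.integrable t)).abs
  have i2 := (hM.integrable t).abs.indicator (hB n).compl
  rw [← integral_add i1 i2]
  refine integral_mono (((hint n).indicator (hB n)).sub (hM.integrable t)).abs (i1.add i2)
    fun ω => ?_
  by_cases h : ω ∈ {ω | |M 0 ω| ≤ n}
  · simp [MonotoneStopping.truncation, Set.indicator_of_mem h,
      Set.indicator_of_notMem (show ω ∉ {ω | |M 0 ω| ≤ n}ᶜ from fun h' => h' h)]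
  · simp [MonotoneStopping.truncation, Set.indicator_of_notMem h,
      Set.indicator_of_mem (show ω ∈ {ω | |M 0 ω| ≤ n}ᶜ from h)]

omit [IsProbabilityMeasure P] in
theorem integrable_mul_of_indep {G H : MeasurableSpace Ω}
    (hind : Indep G H P) {f g : Ω → ℝ} (hf : StronglyMeasurable[G] f)
    (hg : StronglyMeasurable[H] g) (hfi : Integrable f P) (hgi : Integrable g P) :
    Integrable (fun ω => f ω * g ω) P := by
  have : IndepFun f g P := by
    rw [IndepFun_iff_Indep]
    exact indep_of_indep_of_le_left (indep_of_indep_of_le_right hind hg.measurable.comap_le)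
      hf.measurable.comap_le
  exact this.integrable_mul hfi hgi

omit [IsProbabilityMeasure P] in
-- Independence turns the L¹ norms of the cross terms in `f g - f' g'` into products of L¹ norms, so
-- L¹ convergence of the factors suffices.
theorem tendsto_setIntegral_mul_of_indep {G H : MeasurableSpace Ω} (hG : G ≤ m0) (hH : H ≤ m0)
    (hind : Indep G H P) {f g : ℕ → Ω → ℝ} {f' g' : Ω → ℝ} (hf : ∀ n, StronglyMeasurable[G] (f n))
    (hg : ∀ n, StronglyMeasurable[H] (g n)) (hf' : StronglyMeasurable[G] f')
    (hg' : StronglyMeasurable[H] g') (hfi : ∀ n, Integrable (f n) P)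
    (hgi : ∀ n, Integrable (g n) P) (hfi' : Integrable f' P) (hgi' : Integrable g' P)
    (hff : Tendsto (fun n => ∫ ω, |f n ω - f' ω| ∂P) atTop (𝓝 0))
    (hgg : Tendsto (fun n => ∫ ω, |g n ω - g' ω| ∂P) atTop (𝓝 0)) (A : Set Ω) :
    Tendsto (fun n => ∫ ω in A, f n ω * g n ω ∂P) atTop (𝓝 (∫ ω in A, f' ω * g' ω ∂P)) := by
  have i1 := fun n => integrable_mul_of_indep hind (hf n) (hg n) (hfi n) (hgi n)
  have i2 := integrable_mul_of_indep hind hf' hg' hfi' hgi'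
  have i3 := fun n => integrable_mul_of_indep hind ((hf n).sub hf').norm (hg' ).norm
    ((hfi n).sub hfi').norm hgi'.norm
  have i4 := fun n => integrable_mul_of_indep hind ((hf n).sub hf').norm ((hg n).sub hg').norm
    ((hfi n).sub hfi').norm ((hgi n).sub hgi').norm
  have i5 := fun n => integrable_mul_of_indep hind hf'.norm ((hg n).sub hg').norm
    hfi'.norm ((hgi n).sub hgi').norm
  have e3 := fun n => integral_mul_of_indep hG hH hind ((hf n).sub hf').norm hg'.norm
  have e4 := fun n => integral_mul_of_indep hG hH hind ((hf n).sub hf').norm ((hg n).sub hg').norm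
  have e5 := fun n => integral_mul_of_indep hG hH hind hf'.norm ((hg n).sub hg').norm
  rw [tendsto_iff_norm_sub_tendsto_zero]
  have hlim : Tendsto (fun n => (∫ ω, |f n ω - f' ω| ∂P) * (∫ ω, |g' ω| ∂P) +
      ((∫ ω, |f n ω - f' ω| ∂P) * (∫ ω, |g n ω - g' ω| ∂P) +
      (∫ ω, |f' ω| ∂P) * ∫ ω, |g n ω - g' ω| ∂P)) atTop (𝓝 0) := by
    simpa using (hff.mul_const _).add ((hff.mul hgg).add (hgg.const_mul _))
  refine squeeze_zero (fun n => norm_nonneg _) (fun n => ?_) hlim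
  simp only [Pi.sub_apply, Real.norm_eq_abs] at i3 i4 i5 e3 e4 e5
  rw [← e3 n, ← e4 n, ← e5 n, ← integral_sub (i1 n).integrableOn i2.integrableOn,
    ← integral_add (i4 n) (i5 n)]
  have i6 : Integrable (fun ω => |f n ω - f' ω| * |g n ω - g' ω| + |f' ω| * |g n ω - g' ω|) P :=
    (i4 n).add (i5 n)
  rw [← integral_add (i3 n) i6]
  refine (norm_integral_le_integral_norm _).trans ?_
  refine (setIntegral_le_integral ((i1 n).sub i2).norm
    (ae_of_all _ fun ω => norm_nonneg _)).trans ?_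
  refine integral_mono ((i1 n).sub i2).norm ((i3 n).add i6) fun ω => ?_
  simp only [Pi.sub_apply, Real.norm_eq_abs]
  rw [← abs_mul, ← abs_mul, ← abs_mul]
  rw [show f n ω * g n ω - f' ω * g' ω = (f n ω - f' ω) * g' ω +
    ((f n ω - f' ω) * (g n ω - g' ω) + f' ω * (g n ω - g' ω)) by ring]
  exact (abs_add_le _ _).trans (add_le_add le_rfl (abs_add_le _ _))

theorem Martingale.mul_of_indepFun [𝓕.IsRightContinuous] (hM : Martingale M 𝓕 P)
    (hN : Martingale N 𝓕 P) (hcM : ∀ ω, Continuous fun t => M t ω)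
    (hcN : ∀ ω, Continuous fun t => N t ω)
    (hind : IndepFun (fun ω t => M t ω) (fun ω t => N t ω) P) :
    Martingale (fun t ω => M t ω * N t ω) 𝓕 P := by
  have hmM : Measurable fun ω t => M t ω :=
    measurable_pi_lambda _ fun t => (hM.stronglyMeasurable t).measurable.mono (𝓕.le t) le_rfl
  have hmN : Measurable fun ω t => N t ω :=
    measurable_pi_lambda _ fun t => (hN.stronglyMeasurable t).measurable.mono (𝓕.le t) le_rfl
  have hG := hmM.comap_le
  have hH := hmN.comap_le
  rw [IndepFun_iff_Indep] at hind
  have hMG : ∀ t,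
      StronglyMeasurable[MeasurableSpace.comap (fun ω t => M t ω) inferInstance] (M t) :=
    fun t => ((measurable_pi_apply t).comp (comap_measurable fun ω t => M t ω)).stronglyMeasurable
  have hNH : ∀ t,
      StronglyMeasurable[MeasurableSpace.comap (fun ω t => N t ω) inferInstance] (N t) :=
    fun t => ((measurable_pi_apply t).comp (comap_measurable fun ω t => N t ω)).stronglyMeasurable
  refine martingale_of_setIntegral_eq
    (fun t => (hM.stronglyAdapted t).mul (hN.stronglyAdapted t))
    (fun t => integrable_mul_of_indep hind (hMG t) (hNH t) (hM.integrable t) (hN.integrable t))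
    fun s t hst A hA => ?_
  have hlim := fun u => tendsto_setIntegral_mul_of_indep hG hH hind
    (fun n => stronglyMeasurable_truncation hMG hcM n u)
    (fun n => stronglyMeasurable_truncation hNH hcN n u) (hMG u) (hNH u)
    (fun n => (Martingale.truncation hM hcM n).integrable u)
    (fun n => (Martingale.truncation hN hcN n).integrable u) (hM.integrable u) (hN.integrable u)
    (tendsto_integral_abs_truncation_sub hM hcM u) (tendsto_integral_abs_truncation_sub hN hcN u) A
  refine tendsto_nhds_unique (hlim s) ((hlim t).congr fun n => Eq.symm ?_)
  exact Martingale.setIntegral_mul_eq_of_bounded (Martingale.truncation hM hcM n)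
    (Martingale.truncation hN hcN n) (continuous_truncation hcM n)
    (boundedBy_truncation hM.stronglyAdapted hcM n)
    (boundedBy_truncation hN.stronglyAdapted hcN n) hG hH hind
    (fun u => stronglyMeasurable_truncation hMG hcM n u)
    (fun u => stronglyMeasurable_truncation hNH hcN n u) hst hA

theorem martingale_finsetProd [𝓕.IsRightContinuous] {ι : Type*} {M : ι → ℝ≥0 → Ω → ℝ}
    (hM : ∀ i, Martingale (M i) 𝓕 P) (hc : ∀ i ω, Continuous fun t => M i t ω)
    (hind : iIndepFun (fun i ω (t : ℝ≥0) => M i t ω) P) (s : Finset ι) :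
    Martingale (fun t ω => ∏ i ∈ s, M i t ω) 𝓕 P := by
  classical
  induction s using Finset.induction_on with
  | empty => simpa using martingale_const 𝓕 P (1 : ℝ)
  | insert i s hi ih =>
    simp_rw [Finset.prod_insert hi]
    refine Martingale.mul_of_indepFun (hM i) ih (hc i)
      (fun ω => continuous_finsetProd _ fun j _ => hc j ω) ?_
    have := (hind.indepFun_finsetProd_of_notMem (fun j => measurable_pi_lambda _ fun t =>
      ((hM j).stronglyMeasurable t).measurable.mono (𝓕.le t) le_rfl) hi).symm
    convert! this using 1
    ext ω t
    simp [Finset.prod_apply]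

end Truncation

end MonotoneStopping

namespace MonotoneStopping

variable {Ω : Type*} {m0 : MeasurableSpace Ω}

/-! ### Absorption of nonnegative martingales at zero. -/

section Absorption

variable {𝓕 : Filtration ℝ≥0 m0} {P : Measure Ω} [IsProbabilityMeasure P] {M : ℝ≥0 → Ω → ℝ}

/-- On this event `M t` may be replaced by the value sampled at the hitting time, which is at most
`ε` by continuity. -/
theorem Martingale.setIntegral_hittingAfter_lt_le [𝓕.IsRightContinuous] (hM : Martingale M 𝓕 P)
    (hc : ∀ ω, Continuous fun t => M t ω) {ε : ℝ} (hε : 0 ≤ ε) (t : ℝ≥0) :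
    ∫ ω in {ω | hittingAfter M (Set.Iio ε) 0 ω < t}, M t ω ∂P ≤ ε := by
  have hτ := isStoppingTime_hittingAfter_of_isOpen hM.stronglyAdapted hc (isOpen_Iio (a := ε))
  have hσ := isStoppingTime_untopA_min hτ t
  have hL := fun ω => untopA_min_le t (hittingAfter M (Set.Iio ε) 0 ω)
  have hA : MeasurableSet[hσ.measurableSpace] {ω | hittingAfter M (Set.Iio ε) 0 ω < t} := by
    have := hσ.measurableSet_lt' t
    simpa only [coe_untopA_min, min_lt_iff, lt_self_iff_false, false_or] using this
  have hA0 := hσ.measurableSpace_le _ hA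
  rw [← Martingale.setIntegral_stopped hM hc hσ hL hA]
  refine (setIntegral_mono_on (g := fun _ => ε)
    (Martingale.integrable_stopped hM hc hσ hL).integrableOn
    (integrable_const ε).integrableOn hA0 fun ω hω => ?_).trans ?_
  · have hlt : hittingAfter M (Set.Iio ε) 0 ω < t := hω
    obtain ⟨u, hu⟩ := WithTop.ne_top_iff_exists.1 hlt.ne_top
    have hmin : (min (t : WithTop ℝ≥0) (hittingAfter M (Set.Iio ε) 0 ω)).untopA = u := by
      rw [min_eq_right hlt.le, ← hu]
      rfl
    have := mem_closure_of_hittingAfter_eq (hc ω) hu.symm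
    rw [closure_Iio] at this
    rw [hmin]
    exact this
  · rw [setIntegral_const, smul_eq_mul]
    exact mul_le_of_le_one_left hε measureReal_le_one

theorem Martingale.ae_forall_eq_zero [𝓕.IsRightContinuous] (hM : Martingale M 𝓕 P)
    (hc : ∀ ω, Continuous fun t => M t ω) (h0 : ∀ᵐ ω ∂P, ∀ t, 0 ≤ M t ω) :
    ∀ᵐ ω ∂P, ∀ s t, s ≤ t → M s ω = 0 → M t ω = 0 := by
  have key : ∀ t : ℝ≥0, ∀ᵐ ω ∂P, ∀ s < t, M s ω = 0 → M t ω = 0 := by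
    intro t
    -- Every path with a zero before `t` lies in all `B k`, and `M t` integrates to at most `1 / (k
    -- + 1)` over their intersection.
    set B := fun k : ℕ => {ω | hittingAfter M (Set.Iio (1 / ((k : ℝ) + 1))) 0 ω < t} with hB
    have hBm : ∀ k, MeasurableSet (B k) := fun k => 𝓕.le t _
      ((isStoppingTime_hittingAfter_of_isOpen hM.stronglyAdapted hc isOpen_Iio).measurableSet_lt t)
    have hle : ∀ k : ℕ, ∫ ω in ⋂ k, B k, M t ω ∂P ≤ 1 / ((k : ℝ) + 1) := fun k =>
      (setIntegral_mono_set (hM.integrable t).integrableOn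
        (ae_restrict_of_ae (h0.mono fun ω h => h t)) (Set.iInter_subset B k).eventuallyLE).trans
        (Martingale.setIntegral_hittingAfter_lt_le hM hc (by positivity) t)
    have hz : ∫ ω in ⋂ k, B k, M t ω ∂P = 0 :=
      le_antisymm (ge_of_tendsto' tendsto_one_div_add_atTop_nhds_zero_nat hle)
        (integral_nonneg_of_ae (ae_restrict_of_ae (h0.mono fun ω h => h t)))
    rw [setIntegral_eq_zero_iff_of_nonneg_ae (ae_restrict_of_ae (h0.mono fun ω h => h t))
      (hM.integrable t).integrableOn, Filter.EventuallyEq,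
      ae_restrict_iff' (MeasurableSet.iInter hBm)] at hz
    filter_upwards [hz] with ω hω s hs hs0
    refine hω (Set.mem_iInter.2 fun k => ?_)
    exact hittingAfter_lt_iff.2 ⟨s, ⟨zero_le, hs⟩, by
      rw [hs0]; exact Set.mem_Iio.2 (by positivity)⟩
  obtain ⟨D, hD, hd⟩ := TopologicalSpace.exists_countable_dense ℝ≥0
  -- The exceptional set of `key` depends on `t`; a countable dense set of times and continuity give
  -- one null set for all times.
  filter_upwards [(ae_ball_iff hD).2 fun q _ => key q] with ω hω s t hst hs
  rcases hst.eq_or_lt with rfl | hlt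
  · exact hs
  · have hcl : t ∈ closure (Set.Ioi s ∩ D) := hd.open_subset_closure_inter isOpen_Ioi hlt
    have := map_mem_closure (f := fun t => M t ω) (t := {0}) (hc ω) hcl
      fun q hq => hω q hq.2 s hq.1 hs
    simpa using this

end Absorption

end MonotoneStopping

namespace MonotoneStopping

/-! ### Integrals along one path: atoms, continuity and Riemann sums. -/

section Pathwise

variable {μ : Measure ℝ≥0} {r : ℝ≥0 → ℝ}

theorem setIntegral_Ioc_sub (hr : ∀ t, IntegrableOn r (Set.Ioc 0 t) μ) {s t : ℝ≥0} (hst : s ≤ t) :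
    ∫ u in Set.Ioc 0 t, r u ∂μ - ∫ u in Set.Ioc 0 s, r u ∂μ = ∫ u in Set.Ioc s t, r u ∂μ := by
  rw [← Set.Ioc_union_Ioc_eq_Ioc (zero_le : 0 ≤ s) hst, setIntegral_union
    (Set.Ioc_disjoint_Ioc_of_le le_rfl) measurableSet_Ioc (hr s)
    ((hr t).mono_set (Set.Ioc_subset_Ioc_left zero_le))]
  ring

/-- The half-open intervals contain `u` and shrink to it, so only the atom at `u` survives. -/
theorem tendsto_setIntegral_Ioc_shrink (hr : ∀ t, IntegrableOn r (Set.Ioc 0 t) μ)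
    {l v : ℕ → ℝ≥0} {u t : ℝ≥0} (hl : ∀ n, l n < u) (hv : ∀ n, u ≤ v n) (hvt : ∀ n, v n ≤ t)
    (hlu : Tendsto l atTop (𝓝 u)) (hvu : Tendsto v atTop (𝓝 u)) :
    Tendsto (fun n => ∫ w in Set.Ioc (l n) (v n), r w ∂μ) atTop (𝓝 (μ.real {u} * r u)) := by
  rw [← smul_eq_mul, ← integral_singleton, ← integral_indicator (measurableSet_singleton u)]
  simp_rw [← integral_indicator measurableSet_Ioc]
  have hsub : ∀ n, Set.Ioc (l n) (v n) ⊆ Set.Ioc 0 t := fun n => Set.Ioc_subset_Ioc zero_le (hvt n)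
  refine tendsto_integral_of_dominated_convergence ((Set.Ioc 0 t).indicator fun w => |r w|)
    (fun n => ?_) ((integrable_indicator_iff measurableSet_Ioc).2 (hr t).abs)
    (fun n => ae_of_all _ fun w => ?_) (ae_of_all _ fun w => ?_)
  · exact ((integrable_indicator_iff measurableSet_Ioc).2
      ((hr t).mono_set (hsub n))).aestronglyMeasurable
  · rw [norm_indicator_eq_indicator_norm]
    exact Set.indicator_le_indicator_of_subset (hsub n) (fun _ => abs_nonneg _) w
  · refine tendsto_const_nhds.congr' ?_
    rcases lt_trichotomy w u with h | rfl | h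
    · filter_upwards [hlu.eventually_const_lt h] with n hn
      rw [Set.indicator_of_notMem (by simpa using h.ne), Set.indicator_of_notMem]
      exact fun hw => hn.not_gt hw.1
    · rw [Set.indicator_of_mem (Set.mem_singleton w)]
      refine Eventually.of_forall fun n => ?_
      have hw : w ∈ Set.Ioc (l n) (v n) := ⟨hl n, hv n⟩
      exact (Set.indicator_of_mem hw r).symm
    · filter_upwards [hvu.eventually_lt_const h] with n hn
      rw [Set.indicator_of_notMem (by simpa using h.ne'), Set.indicator_of_notMem]
      exact fun hw => hn.not_ge hw.2

/-- The left side is the jump of the exponent at `u`. Since `x` and `m` are continuous and `m u ≠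
0`, the exponential cannot jump. -/
theorem mul_measure_singleton_eq_zero_of_eq_mul_exp (hr : ∀ t, IntegrableOn r (Set.Ioc 0 t) μ)
    {x m : ℝ≥0 → ℝ} (hx : Continuous x) (hm : Continuous m)
    (hxm : ∀ t, x t = m t * Real.exp (∫ u in Set.Ioc 0 t, r u ∂μ)) {u : ℝ≥0} (hu : 0 < u)
    (hxu : x u ≠ 0) : μ.real {u} * r u = 0 := by
  obtain ⟨l, -, hl, hlu⟩ := exists_seq_strictMono_tendsto' hu
  have h1 := tendsto_setIntegral_Ioc_shrink hr (fun n => (hl n).2) (fun _ => le_rfl)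
    (fun _ => le_refl u) hlu tendsto_const_nhds
  have h2 : Tendsto (fun n => ∫ w in Set.Ioc 0 (l n), r w ∂μ) atTop
      (𝓝 (∫ w in Set.Ioc 0 u, r w ∂μ - μ.real {u} * r u)) := by
    refine (h1.const_sub (∫ w in Set.Ioc 0 u, r w ∂μ)).congr fun n => ?_
    rw [← setIntegral_Ioc_sub hr (hl n).2.le]
    ring
  have h3 : Tendsto (fun n => x (l n)) atTop
      (𝓝 (m u * Real.exp (∫ w in Set.Ioc 0 u, r w ∂μ - μ.real {u} * r u))) := by
    simp_rw [hxm]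
    exact ((hm.tendsto u).comp hlu).mul ((Real.continuous_exp.tendsto _).comp h2)
  have h4 := tendsto_nhds_unique h3 ((hx.tendsto u).comp hlu)
  have hmu : m u ≠ 0 := fun h => hxu (by rw [hxm, h, zero_mul])
  rw [hxm u] at h4
  have := Real.exp_injective (mul_left_cancel₀ hmu h4)
  linarith

theorem continuous_setIntegral_Ioc {y : ℝ≥0 → ℝ} (hy : ∀ t, IntegrableOn y (Set.Ioc 0 t) μ)
    (h0 : ∀ u, 0 < u → μ.real {u} * y u = 0) :
    Continuous fun t => ∫ u in Set.Ioc 0 t, y u ∂μ := by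
  rw [continuous_iff_continuousAt]
  intro t
  simp_rw [ContinuousAt, ← integral_indicator measurableSet_Ioc]
  -- `μ.real {t} = 0` would also allow an infinite atom; integrability of `y` with `y t ≠ 0`
  -- excludes it.
  have hfin : 0 < t → y t ≠ 0 → μ {t} = 0 := by
    intro ht hyt
    have h1 : μ.real {t} = 0 := (mul_eq_zero.1 (h0 t ht)).resolve_right hyt
    have h2 : IntegrableOn y {t} μ :=
      (hy t).mono_set (Set.singleton_subset_iff.2 ⟨ht, le_rfl⟩)
    rw [integrableOn_singleton_iff] at h2
    exact (measureReal_eq_zero_iff (h2.resolve_left (by simpa using hyt)).ne).1 h1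
  refine tendsto_integral_filter_of_dominated_convergence
    ((Set.Ioc 0 (t + 1)).indicator fun w => |y w|) (Eventually.of_forall fun u => ?_) ?_
    ((integrable_indicator_iff measurableSet_Ioc).2 (hy (t + 1)).abs) ?_
  · exact ((integrable_indicator_iff measurableSet_Ioc).2 (hy u)).aestronglyMeasurable
  · filter_upwards [eventually_lt_nhds (lt_add_one t)] with u hu
    refine ae_of_all _ fun w => ?_
    rw [norm_indicator_eq_indicator_norm]
    exact Set.indicator_le_indicator_of_subset (Set.Ioc_subset_Ioc_right hu.le)
      (fun _ => abs_nonneg _) w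
  · have hne : ∀ w, w ≠ t ∨ w = 0 ∨ y w = 0 →
        Tendsto (fun u => (Set.Ioc 0 u).indicator y w) (𝓝 t) (𝓝 ((Set.Ioc 0 t).indicator y w)) := by
      intro w hw
      rcases eq_or_ne w 0 with rfl | hw0
      · simp
      by_cases hyw : y w = 0
      · have : ∀ u, (Set.Ioc 0 u).indicator y w = 0 := fun u =>
          Set.indicator_apply_eq_zero.2 fun _ => hyw
        simp [this]
      have hwt : w ≠ t := hw.resolve_right (by simp [hw0, hyw])
      refine tendsto_const_nhds.congr' ?_
      rcases lt_or_gt_of_ne hwt with h | h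
      · filter_upwards [eventually_gt_nhds h] with u hu
        rw [Set.indicator_of_mem (show w ∈ Set.Ioc 0 t from ⟨pos_iff_ne_zero.2 hw0, h.le⟩),
          Set.indicator_of_mem (show w ∈ Set.Ioc 0 u from ⟨pos_iff_ne_zero.2 hw0, hu.le⟩)]
      · filter_upwards [eventually_lt_nhds h] with u hu
        rw [Set.indicator_of_notMem fun hw => h.not_ge hw.2,
          Set.indicator_of_notMem fun hw => hu.not_ge hw.2]
    by_cases hyt : 0 < t ∧ y t ≠ 0
    · have : ∀ᵐ w ∂μ, w ≠ t := by
        rw [ae_iff]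
        simpa using hfin hyt.1 hyt.2
      exact this.mono fun w hw => hne w (Or.inl hw)
    · refine ae_of_all _ fun w => hne w ?_
      by_cases hwt : w = t
      · subst hwt
        right
        by_contra! h
        exact hyt ⟨pos_iff_ne_zero.2 h.1, h.2⟩
      · exact Or.inl hwt

/-- The function `(1 - exp (-x)) / x`, continuously extended by `1` at `0`. -/
noncomputable def expSlope : ℝ → ℝ := dslope (fun x => -Real.exp (-x)) 0

theorem mul_expSlope (x : ℝ) : x * expSlope x = 1 - Real.exp (-x) := by
  have := sub_smul_dslope (fun x => -Real.exp (-x)) 0 x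
  simp only [sub_zero, smul_eq_mul, neg_zero, Real.exp_zero] at this
  rw [expSlope, this]
  ring

theorem expSlope_zero : expSlope 0 = 1 := by
  have : HasDerivAt (fun x : ℝ => -Real.exp (-x)) 1 0 := by
    have := ((hasDerivAt_neg (0 : ℝ)).exp).neg
    rw [neg_zero, Real.exp_zero, one_mul, neg_neg] at this
    exact this
  rw [expSlope, dslope_same, this.deriv]

theorem continuous_expSlope : Continuous expSlope := by
  rw [← continuousOn_univ]
  exact (continuousOn_dslope univ_mem).2
    ⟨by fun_prop, by fun_prop⟩

/-- Writing `1 - exp(-δ) = δ * expSlope δ` with `δ` the integral of `r` over a cell turns the sum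
into a single integral, accessible to dominated convergence. -/
theorem sum_mul_one_sub_exp_eq_setIntegral (hr : ∀ t, IntegrableOn r (Set.Ioc 0 t) μ)
    (x : ℝ≥0 → ℝ) {p : ℕ → ℝ≥0} (hp : Monotone p) (n : ℕ) :
    ∑ k ∈ Finset.range n, x (p (k + 1)) *
        (1 - Real.exp (-∫ u in Set.Ioc (p k) (p (k + 1)), r u ∂μ)) =
      ∫ w in Set.Ioc (p 0) (p n), ∑ k ∈ Finset.range n,
        (Set.Ioc (p k) (p (k + 1))).indicator (fun w => x (p (k + 1)) *
          expSlope (∫ u in Set.Ioc (p k) (p (k + 1)), r u ∂μ) * r w) w ∂μ := by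
  have hi : ∀ k, IntegrableOn (fun w => x (p (k + 1)) *
      expSlope (∫ u in Set.Ioc (p k) (p (k + 1)), r u ∂μ) * r w) (Set.Ioc (p k) (p (k + 1))) μ :=
    fun k => ((hr _).mono_set (Set.Ioc_subset_Ioc_left zero_le)).const_mul _
  rw [integral_finsetSum _ fun k _ =>
    ((integrable_indicator_iff measurableSet_Ioc).2 (hi k)).integrableOn]
  refine Finset.sum_congr rfl fun k hk => ?_
  have hkn : k + 1 ≤ n := Finset.mem_range.1 hk
  rw [setIntegral_indicator measurableSet_Ioc, Set.inter_eq_right.2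
    (Set.Ioc_subset_Ioc (hp (Nat.zero_le k)) (hp hkn)), integral_const_mul, ← mul_expSlope]
  ring

theorem exists_mem_Ioc_succ {p : ℕ → ℝ≥0} (hp : Monotone p) {n : ℕ} {w : ℝ≥0}
    (hw : w ∈ Set.Ioc (p 0) (p n)) : ∃ k < n, w ∈ Set.Ioc (p k) (p (k + 1)) := by
  rw [← hp.biUnion_Ico_Ioc_map_succ 0 n] at hw
  simp only [Set.mem_iUnion] at hw
  obtain ⟨k, hk, hw⟩ := hw
  exact ⟨k, hk.2, hw⟩

theorem sum_indicator_Ioc_succ {p : ℕ → ℝ≥0} (hp : Monotone p) {n k : ℕ} (hk : k < n) {w : ℝ≥0}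
    (hw : w ∈ Set.Ioc (p k) (p (k + 1))) (f : ℕ → ℝ≥0 → ℝ) :
    ∑ j ∈ Finset.range n, (Set.Ioc (p j) (p (j + 1))).indicator (f j) w = f k w := by
  rw [Finset.sum_eq_single_of_mem k (Finset.mem_range.2 hk), Set.indicator_of_mem hw]
  intro j _ hjk
  refine Set.indicator_of_notMem (fun hj => ?_) _
  exact Set.disjoint_left.1 (hp.pairwise_disjoint_on_Ioc_succ hjk) hj hw

/-- The partition of `[s, s + h]` into `n + 1` intervals of equal length. -/
noncomputable def equipartition (s h : ℝ≥0) (n k : ℕ) : ℝ≥0 := s + k * (h / (n + 1))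

theorem monotone_equipartition (s h : ℝ≥0) (n : ℕ) : Monotone (equipartition s h n) :=
  fun k l hkl => by simp only [equipartition]; gcongr

theorem equipartition_zero (s h : ℝ≥0) (n : ℕ) : equipartition s h n 0 = s := by
  simp [equipartition]

theorem equipartition_last (s h : ℝ≥0) (n : ℕ) : equipartition s h n (n + 1) = s + h := by
  simp only [equipartition]
  push_cast
  rw [mul_div_cancel₀ _ (by positivity)]

theorem equipartition_succ (s h : ℝ≥0) (n k : ℕ) :
    equipartition s h n (k + 1) = equipartition s h n k + h / (n + 1) := by
  simp only [equipartition]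
  push_cast
  ring

theorem tendsto_div_add_one (h : ℝ≥0) : Tendsto (fun n : ℕ => h / ((n : ℝ≥0) + 1)) atTop (𝓝 0) := by
  have := (tendsto_one_div_add_atTop_nhds_zero_nat (𝕜 := ℝ≥0)).const_mul h
  simpa [div_eq_mul_inv] using this

theorem tendsto_sum_mul_one_sub_exp (hr : ∀ t, IntegrableOn r (Set.Ioc 0 t) μ)
    {x : ℝ≥0 → ℝ} (hx : Continuous x) (h0 : ∀ u, 0 < u → x u ≠ 0 → μ.real {u} * r u = 0)
    (s h : ℝ≥0) :
    Tendsto (fun n => ∑ k ∈ Finset.range (n + 1), x (equipartition s h n (k + 1)) *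
        (1 - Real.exp (-∫ u in Set.Ioc (equipartition s h n k) (equipartition s h n (k + 1)),
          r u ∂μ))) atTop (𝓝 (∫ u in Set.Ioc s (s + h), x u * r u ∂μ)) := by
  simp_rw [fun n => sum_mul_one_sub_exp_eq_setIntegral hr x (monotone_equipartition s h n) (n + 1),
    equipartition_zero, equipartition_last]
  have hmono := monotone_equipartition s h
  have hle : ∀ n k, k < n + 1 → equipartition s h n (k + 1) ≤ s + h := fun n k hk =>
    (hmono n (Nat.succ_le_of_lt hk)).trans_eq (equipartition_last s h n)
  obtain ⟨Cx, hCx⟩ := (isCompact_Icc (a := 0) (b := s + h)).exists_bound_of_continuousOn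
    hx.continuousOn
  set T := ∫ u in Set.Ioc 0 (s + h), |r u| ∂μ with hT
  obtain ⟨Cφ, hCφ⟩ := (isCompact_Icc (a := -T) (b := T)).exists_bound_of_continuousOn
    continuous_expSlope.continuousOn
  have hδ : ∀ l v, v ≤ s + h → |∫ u in Set.Ioc l v, r u ∂μ| ≤ T := fun l v hv =>
    (abs_integral_le_integral_abs).trans (setIntegral_mono_set (hr _).abs
      (ae_of_all _ fun _ => abs_nonneg _)
      (Set.Ioc_subset_Ioc zero_le hv).eventuallyLE)
  have hri : IntegrableOn r (Set.Ioc s (s + h)) μ :=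
    (hr _).mono_set (Set.Ioc_subset_Ioc_left zero_le)
  refine tendsto_integral_of_dominated_convergence (fun w => Cx * Cφ * |r w|) (fun n => ?_)
    (hri.abs.const_mul _) (fun n => ?_) ?_
  · refine (integrable_finsetSum _ fun k hk => ?_).aestronglyMeasurable
    refine Integrable.indicator ?_ measurableSet_Ioc
    exact hri.const_mul _
  · refine (ae_restrict_iff' measurableSet_Ioc).2 (ae_of_all _ fun w hw => ?_)
    obtain ⟨k, hk, hwk⟩ := exists_mem_Ioc_succ (hmono n) (n := n + 1) (w := w)
      (by rwa [equipartition_zero, equipartition_last])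
    rw [sum_indicator_Ioc_succ (hmono n) hk hwk, norm_mul, norm_mul]
    refine mul_le_mul_of_nonneg_right ?_ (norm_nonneg _)
    refine mul_le_mul (hCx _ ⟨zero_le, hle n k hk⟩) (hCφ _ ?_) (norm_nonneg _)
      ((norm_nonneg _).trans (hCx 0 ⟨le_rfl, zero_le⟩))
    exact abs_le.1 (hδ _ _ (hle n k hk))
  · refine (ae_restrict_iff' measurableSet_Ioc).2 (ae_of_all _ fun w hw => ?_)
    have hex := fun n : ℕ => exists_mem_Ioc_succ (hmono n) (n := n + 1) (w := w)
      (by rwa [equipartition_zero, equipartition_last])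
    choose k hk hwk using hex
    simp_rw [fun n : ℕ => sum_indicator_Ioc_succ (hmono n) (hk n) (hwk n)]
    have hh := tendsto_div_add_one h
    have hl : Tendsto (fun n => equipartition s h n (k n)) atTop (𝓝 w) := by
      refine tendsto_of_tendsto_of_tendsto_of_le_of_le (g := fun n : ℕ => w - h / ((n : ℝ≥0) + 1))
        (h := fun _ => w) ?_ tendsto_const_nhds (fun n => ?_) fun n => (hwk n).1.le
      · simpa using (tendsto_const_nhds (x := w)).sub hh
      · rw [tsub_le_iff_right, ← equipartition_succ]
        exact (hwk n).2
    have hv : Tendsto (fun n => equipartition s h n (k n + 1)) atTop (𝓝 w) := by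
      simp_rw [equipartition_succ]
      simpa using hl.add hh
    have hint := tendsto_setIntegral_Ioc_shrink hr (fun n => (hwk n).1) (fun n => (hwk n).2)
      (fun n => hle n _ (hk n)) hl hv
    have hlim := ((((hx.tendsto w).comp hv).mul
      ((continuous_expSlope.tendsto _).comp hint)).mul_const (r w))
    -- An atom at `w` can matter only if `x w = 0`, and then both sides vanish; otherwise the slope
    -- is taken at `0`, where it is `1`.
    have hval : x w * expSlope (μ.real {w} * r w) * r w = x w * r w := by
      by_cases hxw : x w = 0
      · simp [hxw]
      · rw [h0 w (zero_le.trans_lt hw.1) hxw, expSlope_zero, mul_one]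
    rw [← hval]
    exact hlim

end Pathwise

/-! ### Adaptedness of the pathwise integral. -/

section Adaptedness

theorem stronglyMeasurable_integral_of_measurable_Iic {Ω : Type*} {m : MeasurableSpace Ω}
    {μ : Ω → Measure ℝ≥0} [∀ ω, IsFiniteMeasure (μ ω)]
    (hμ : ∀ a, Measurable fun ω => μ ω (Set.Iic a)) (hμ' : Measurable fun ω => μ ω Set.univ)
    {f : Ω × ℝ≥0 → ℝ} (hf : StronglyMeasurable f) :
    StronglyMeasurable fun ω => ∫ s, f (ω, s) ∂μ ω := by
  have hm : Measurable μ := by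
    refine Measurable.measure_of_isPiSystem
      ((BorelSpace.measurable_eq (α := ℝ≥0)).trans (borel_eq_generateFrom_Iic ℝ≥0)) isPiSystem_Iic
      ?_ hμ'
    rintro _ ⟨a, rfl⟩
    exact hμ a
  -- The masses of `μ ω` are finite but not uniformly so; this factor normalizes them to at most
  -- `1`, which makes a finite kernel.
  set c : Ω → ℝ≥0∞ := fun ω => (1 + μ ω Set.univ)⁻¹ with hc
  have hcm : Measurable c := (measurable_const.add hμ').inv
  have hκm : Measurable fun ω => c ω • μ ω := by
    refine Measure.measurable_of_measurable_coe _ fun s hs => ?_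
    simp only [Measure.smul_apply, smul_eq_mul]
    exact hcm.mul ((Measure.measurable_coe hs).comp hm)
  set κ : Kernel Ω ℝ≥0 := ⟨fun ω => c ω • μ ω, hκm⟩ with hκ
  have : IsFiniteKernel κ := by
    refine ⟨1, ENNReal.one_lt_top, fun ω => ?_⟩
    change (c ω • μ ω) Set.univ ≤ 1
    rw [Measure.smul_apply, smul_eq_mul, hc, mul_comm, ← div_eq_mul_inv]
    exact ENNReal.div_le_of_le_mul (by rw [one_mul]; exact le_add_self)
  have h1 := hf.integral_kernel_prod_right' (κ := κ)
  have h2 : ∀ ω, ∫ s, f (ω, s) ∂μ ω = (1 + μ ω Set.univ).toReal * ∫ s, f (ω, s) ∂κ ω := by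
    intro ω
    change _ = _ * ∫ s, f (ω, s) ∂(c ω • μ ω)
    rw [integral_smul_measure, smul_eq_mul, ← mul_assoc, ← ENNReal.toReal_mul, hc,
      ENNReal.mul_inv_cancel (by simp) (by simp), ENNReal.toReal_one, one_mul]
  simp_rw [h2]
  exact ((measurable_const.add hμ').ennreal_toReal.stronglyMeasurable).mul h1

variable {Ω : Type*} {m0 : MeasurableSpace Ω} {𝓕 : Filtration ℝ≥0 m0}
  {V : Ω → StieltjesFunction ℝ≥0} {H : ℝ≥0 → Ω → ℝ}

theorem stronglyAdapted_stieltjesIntegral (hV : StronglyAdapted 𝓕 fun t ω => V ω t)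
    (hH : IsStronglyProgressive 𝓕 H) : StronglyAdapted 𝓕 (stieltjesIntegral V H) := by
  intro t
  have hVm : ∀ s ≤ t, Measurable[𝓕 t] fun ω => V ω s := fun s hs =>
    (hV s).measurable.mono (𝓕.mono hs) le_rfl
  have hfin : ∀ ω, IsFiniteMeasure ((V ω).measure.restrict (Set.Ioc 0 t)) := fun ω =>
    ⟨by
      rw [Measure.restrict_apply_univ, StieltjesFunction.measure_Ioc]
      exact ENNReal.ofReal_lt_top⟩
  -- Capping time at `t` makes the integrand measurable at time `t` and changes nothing on `(0, t]`.
  have hf : @StronglyMeasurable _ _ _ (@Prod.instMeasurableSpace _ _ (𝓕 t) inferInstance)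
      fun q : Ω × ℝ≥0 => H (min q.2 t) q.1 := by
    refine (hH t).comp_measurable (g := fun q : Ω × ℝ≥0 =>
      ((⟨min q.2 t, Set.mem_Iic.2 (min_le_right _ _)⟩, q.1) : Set.Iic t × Ω)) ?_
    refine @Measurable.prodMk _ (@Prod.instMeasurableSpace _ _ (𝓕 t) inferInstance) _ _ _ (𝓕 t)
      _ _ ?_ (@measurable_fst _ _ (𝓕 t) _)
    exact Measurable.subtype_mk ((@measurable_snd _ _ (𝓕 t) _).min measurable_const)
  have := @stronglyMeasurable_integral_of_measurable_Iic Ω (𝓕 t)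
    (fun ω => (V ω).measure.restrict (Set.Ioc 0 t)) hfin (fun a => ?_) ?_ _ hf
  · convert! this using 2 with ω
    refine setIntegral_congr_fun measurableSet_Ioc fun s hs => ?_
    simp only [min_eq_left hs.2]
  · simp_rw [Measure.restrict_apply measurableSet_Iic]
    have : ∀ ω, (V ω).measure (Set.Iic a ∩ Set.Ioc 0 t) =
        ENNReal.ofReal (V ω (min a t) - V ω 0) := fun ω => by
      rw [← StieltjesFunction.measure_Ioc]
      congr 1
      ext u
      simp only [Set.mem_inter_iff, Set.mem_Iic, Set.mem_Ioc, le_min_iff]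
      tauto
    simp_rw [this]
    exact ((hVm _ (min_le_right _ _)).sub (hVm 0 zero_le)).ennreal_ofReal
  · simp_rw [Measure.restrict_apply_univ, StieltjesFunction.measure_Ioc]
    exact ((hVm t le_rfl).sub (hVm 0 zero_le)).ennreal_ofReal

end Adaptedness

end MonotoneStopping

namespace MonotoneStopping

/-! ### Bounds for the sums, uniform in the partition. -/

section PathwiseBounds

variable {μ : Measure ℝ≥0} {r : ℝ≥0 → ℝ}

/-- A bound valid strictly before `v` extends to `v` when the integral has no jump there. -/
theorem setIntegral_Ioc_le_of_forall_lt (hr : ∀ t, IntegrableOn r (Set.Ioc 0 t) μ) {s v : ℝ≥0}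
    (hsv : s < v) (hv : μ.real {v} * r v = 0) {c : ℝ}
    (h : ∀ w ∈ Set.Ioo s v, ∫ u in Set.Ioc 0 w, r u ∂μ ≤ c) : ∫ u in Set.Ioc 0 v, r u ∂μ ≤ c := by
  obtain ⟨l, -, hl, hlv⟩ := exists_seq_strictMono_tendsto' hsv
  have h1 := tendsto_setIntegral_Ioc_shrink hr (fun n => (hl n).2) (fun _ => le_rfl)
    (fun _ => le_refl v) hlv tendsto_const_nhds
  rw [hv] at h1
  have h2 := h1.const_sub (∫ u in Set.Ioc 0 v, r u ∂μ)
  rw [sub_zero] at h2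
  refine le_of_tendsto' h2 fun n => ?_
  rw [← setIntegral_Ioc_sub hr (hl n).2.le, sub_sub_cancel]
  exact h _ (hl n)

theorem abs_one_sub_exp_neg_le (x : ℝ) : |1 - Real.exp (-x)| ≤ Real.exp |x| * |x| := by
  have h1 := Real.add_one_le_exp (-x)
  have h2 := Real.add_one_le_exp x
  have h3 : Real.exp (-x) * Real.exp x = 1 := by rw [← Real.exp_add]; simp
  rcases le_total 0 x with hx | hx
  · rw [abs_of_nonneg hx, abs_le]
    have : 1 ≤ Real.exp x := Real.one_le_exp hx
    have : Real.exp (-x) ≤ 1 := Real.exp_le_one_iff.2 (by linarith)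
    constructor <;> nlinarith
  · rw [abs_of_nonpos hx, abs_le]
    have : 1 ≤ Real.exp (-x) := Real.one_le_exp (by linarith)
    constructor <;> nlinarith

/-- Cells whose right end is a zero of `x` are dropped. At the last remaining cell `x ≠ 0`, so the
whole integral up to there is at most `C`. -/
theorem sum_ite_setIntegral_le (hr : ∀ t, IntegrableOn r (Set.Ioc 0 t) μ) (h0 : ∀ t, 0 ≤ r t)
    {x : ℝ≥0 → ℝ} {C : ℝ} (hC : 0 ≤ C) (hx : ∀ t, x t ≠ 0 → ∫ u in Set.Ioc 0 t, r u ∂μ ≤ C)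
    {p : ℕ → ℝ≥0} (hp : Monotone p) (n : ℕ) :
    ∑ k ∈ Finset.range n, (if x (p (k + 1)) = 0 then 0 else
      ∫ u in Set.Ioc (p k) (p (k + 1)), r u ∂μ) ≤ C := by
  induction n with
  | zero => simpa using hC
  | succ n ih =>
    by_cases hxn : x (p (n + 1)) = 0
    · rw [Finset.sum_range_succ, if_pos hxn, add_zero]
      exact ih
    · have hnn : ∀ s : Set ℝ≥0, 0 ≤ ∫ u in s, r u ∂μ := fun s => integral_nonneg h0
      calc _ ≤ ∑ k ∈ Finset.range (n + 1), ∫ u in Set.Ioc (p k) (p (k + 1)), r u ∂μ := by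
            refine Finset.sum_le_sum fun k _ => ?_
            split_ifs
            · exact hnn _
            · exact le_rfl
        _ = ∫ u in Set.Ioc 0 (p (n + 1)), r u ∂μ - ∫ u in Set.Ioc 0 (p 0), r u ∂μ := by
            rw [← Finset.sum_range_sub (fun k => ∫ u in Set.Ioc 0 (p k), r u ∂μ)]
            exact Finset.sum_congr rfl fun k _ => (setIntegral_Ioc_sub hr (hp (Nat.le_succ k))).symm
        _ ≤ C := (sub_le_self _ (hnn _)).trans (hx _ hxn)

theorem abs_sum_mul_one_sub_exp_le (hr : ∀ t, IntegrableOn r (Set.Ioc 0 t) μ)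
    {x : ℝ≥0 → ℝ} {C : ℝ} (hxC : ∀ t, |x t| ≤ C)
    (hx : ∀ t, x t ≠ 0 → ∫ u in Set.Ioc 0 t, |r u| ∂μ ≤ C)
    {p : ℕ → ℝ≥0} (hp : Monotone p) (n : ℕ) :
    |∑ k ∈ Finset.range n, x (p (k + 1)) *
        (1 - Real.exp (-∫ u in Set.Ioc (p k) (p (k + 1)), r u ∂μ))| ≤ C * Real.exp C * C := by
  have hC : 0 ≤ C := (abs_nonneg _).trans (hxC 0)
  have hra : ∀ t, IntegrableOn (fun u => |r u|) (Set.Ioc 0 t) μ := fun t => (hr t).abs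
  calc _ ≤ ∑ k ∈ Finset.range n, C * Real.exp C * (if x (p (k + 1)) = 0 then 0 else
        ∫ u in Set.Ioc (p k) (p (k + 1)), |r u| ∂μ) := by
        refine (Finset.abs_sum_le_sum_abs _ _).trans (Finset.sum_le_sum fun k _ => ?_)
        by_cases hxk : x (p (k + 1)) = 0
        · simp [hxk]
        rw [if_neg hxk, abs_mul, mul_assoc]
        have h1 : |∫ u in Set.Ioc (p k) (p (k + 1)), r u ∂μ| ≤
            ∫ u in Set.Ioc (p k) (p (k + 1)), |r u| ∂μ := abs_integral_le_integral_abs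
        have h2 : ∫ u in Set.Ioc (p k) (p (k + 1)), |r u| ∂μ ≤ C := by
          refine (setIntegral_mono_set (hra _) (ae_of_all _ fun _ => abs_nonneg _)
            (Set.Ioc_subset_Ioc_left zero_le).eventuallyLE).trans (hx _ hxk)
        refine mul_le_mul (hxC _) ((abs_one_sub_exp_neg_le _).trans ?_) (abs_nonneg _) hC
        exact mul_le_mul (Real.exp_le_exp.2 (h1.trans h2)) h1 (abs_nonneg _) (Real.exp_nonneg _)
    _ ≤ C * Real.exp C * C := by
        rw [← Finset.mul_sum]
        exact mul_le_mul_of_nonneg_left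
          (sum_ite_setIntegral_le hra (fun _ => abs_nonneg _) hC hx hp n)
          (mul_nonneg hC (Real.exp_nonneg _))

end PathwiseBounds

/-! ### From the multiplicative to the additive decomposition, bounded case. -/

section BoundedDecomposition

variable {Ω : Type*} {m0 : MeasurableSpace Ω} {𝓕 : Filtration ℝ≥0 m0} {P : Measure Ω}
  [IsProbabilityMeasure P] {V : Ω → StieltjesFunction ℝ≥0} {X M R : ℝ≥0 → Ω → ℝ}

theorem integrable_mul_of_bounded_path {μ : Measure ℝ≥0} {r x : ℝ≥0 → ℝ}
    (hr : ∀ t, IntegrableOn r (Set.Ioc 0 t) μ) (hx : Continuous x) (t : ℝ≥0) :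
    IntegrableOn (fun u => x u * r u) (Set.Ioc 0 t) μ := by
  obtain ⟨C, hC⟩ := (isCompact_Icc (a := 0) (b := t)).exists_bound_of_continuousOn hx.continuousOn
  exact (hr t).bdd_mul hx.aestronglyMeasurable
    ((ae_restrict_iff' measurableSet_Ioc).2 (ae_of_all _ fun u hu => hC u ⟨hu.1.le, hu.2⟩))

theorem stieltjesIntegral_le_abs (hR : LocallyIntegrable V R) {s t : ℝ≥0} (hst : s ≤ t) (ω : Ω) :
    stieltjesIntegral V R s ω ≤ ∫ u in Set.Ioc 0 t, |R u ω| ∂(V ω).measure :=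
  (le_abs_self _).trans (abs_integral_le_integral_abs.trans
    (setIntegral_mono_set (hR ω t).abs (ae_of_all _ fun _ => abs_nonneg _)
      (Set.Ioc_subset_Ioc_right hst).eventuallyLE))

/-- The increment of `X` over `[s, s + h]` has the same integral over past events as the sums of
`X_{k+1} (1 - exp(-ΔA))`, which are uniformly bounded and converge to the drift. The bound on `∫ |R|
dV` is asked for only where `X ≠ 0`, because a localizing time cannot control a jump occurring at a
zero of `X`. -/
theorem Martingale.sub_drift_of_bounded (hM : Martingale M 𝓕 P)
    (hcM : ∀ ω, Continuous fun t => M t ω) (hV : StronglyAdapted 𝓕 fun t ω => V ω t)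
    (hX : StronglyAdapted 𝓕 X) (hcX : ∀ ω, Continuous fun t => X t ω)
    (hRp : IsStronglyProgressive 𝓕 R) (hR : LocallyIntegrable V R)
    (hexp : ∀ᵐ ω ∂P, ∀ t, X t ω = M t ω * Real.exp (stieltjesIntegral V R t ω)) {C : ℝ}
    (hXC : ∀ᵐ ω ∂P, ∀ t, |X t ω| ≤ C)
    (hRC : ∀ᵐ ω ∂P, ∀ t, X t ω ≠ 0 → ∫ u in Set.Ioc 0 t, |R u ω| ∂(V ω).measure ≤ C) :
    Martingale (fun t ω => X t ω - X 0 ω - stieltjesIntegral V (fun u ω => X u ω * R u ω) t ω)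
      𝓕 P := by
  set A := stieltjesIntegral V R with hA
  set D := stieltjesIntegral V fun u ω => X u ω * R u ω with hD
  have hAa : StronglyAdapted 𝓕 A := stronglyAdapted_stieltjesIntegral hV hRp
  have hDa : StronglyAdapted 𝓕 D := stronglyAdapted_stieltjesIntegral hV
    ((hX.isStronglyProgressive_of_continuous hcX).mul hRp)
  have hXi : ∀ t, Integrable (X t) P := fun t =>
    Integrable.of_bound ((hX t).mono (𝓕.le t)).aestronglyMeasurable C (hXC.mono fun ω h => h t)
  have hDsub : ∀ s h ω, D (s + h) ω - D s ω =
      ∫ u in Set.Ioc s (s + h), X u ω * R u ω ∂(V ω).measure := fun s h ω =>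
    setIntegral_Ioc_sub (integrable_mul_of_bounded_path (hR ω) (hcX ω)) le_self_add
  have hAsub : ∀ s h n k ω, A (equipartition s h n (k + 1)) ω - A (equipartition s h n k) ω =
      ∫ u in Set.Ioc (equipartition s h n k) (equipartition s h n (k + 1)), R u ω ∂(V ω).measure :=
    fun s h n k ω => setIntegral_Ioc_sub (hR ω) (monotone_equipartition s h n (Nat.le_succ k))
  have hlim : ∀ s h, ∀ᵐ ω ∂P, Tendsto (fun n => ∑ k ∈ Finset.range (n + 1),
      X (equipartition s h n (k + 1)) ω *
        (1 - Real.exp (-(A (equipartition s h n (k + 1)) ω - A (equipartition s h n k) ω))))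
      atTop (𝓝 (D (s + h) ω - D s ω)) := by
    intro s h
    filter_upwards [hexp] with ω hω
    rw [hDsub]
    simp_rw [hAsub s h]
    exact tendsto_sum_mul_one_sub_exp (hR ω) (hcX ω)
      (fun u hu hxu => mul_measure_singleton_eq_zero_of_eq_mul_exp (hR ω) (hcX ω) (hcM ω) hω hu hxu)
      s h
  have hbd : ∀ s h, ∀ᵐ ω ∂P, ∀ n, |∑ k ∈ Finset.range (n + 1),
      X (equipartition s h n (k + 1)) ω *
        (1 - Real.exp (-(A (equipartition s h n (k + 1)) ω - A (equipartition s h n k) ω)))| ≤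
      C * Real.exp C * C := by
    intro s h
    filter_upwards [hXC, hRC] with ω h1 h2 n
    simp_rw [hAsub s h]
    exact abs_sum_mul_one_sub_exp_le (hR ω) h1 h2 (monotone_equipartition s h n) (n + 1)
  have hXm : ∀ t, StronglyMeasurable (X t) := fun t => (hX t).mono (𝓕.le t)
  have hAm : ∀ t, StronglyMeasurable (A t) := fun t => (hAa t).mono (𝓕.le t)
  have hDm : ∀ t, StronglyMeasurable (D t) := fun t => (hDa t).mono (𝓕.le t)
  have hDi' : ∀ s h, Integrable (fun ω => D (s + h) ω - D s ω) P := by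
    intro s h
    refine Integrable.of_bound ((hDm _).sub (hDm _)).aestronglyMeasurable (C * Real.exp C * C) ?_
    filter_upwards [hlim s h, hbd s h] with ω h1 h2
    exact le_of_tendsto' h1.norm h2
  have hDi : ∀ t, Integrable (D t) P := by
    intro t
    refine (hDi' 0 t).congr (ae_of_all _ fun ω => ?_)
    simp [hD, stieltjesIntegral]
  have hsumm : ∀ s h n, StronglyMeasurable fun ω => ∑ k ∈ Finset.range (n + 1),
      X (equipartition s h n (k + 1)) ω *
        (1 - Real.exp (-(A (equipartition s h n (k + 1)) ω - A (equipartition s h n k) ω))) := by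
    intro s h n
    refine Finset.stronglyMeasurable_fun_sum _ fun k _ => (hXm _).mul ?_
    exact stronglyMeasurable_const.sub
      (Real.continuous_exp.comp_stronglyMeasurable ((hAm _).sub (hAm _)).neg)
  have hincr : ∀ s t, s ≤ t → ∀ B, MeasurableSet[𝓕 s] B →
      ∫ ω in B, (M t ω - M s ω) * Real.exp (A s ω) ∂P = 0 ∧
      Integrable (fun ω => (M t ω - M s ω) * Real.exp (A s ω)) P := by
    intro s t hst B hB
    have hAe : StronglyMeasurable[𝓕 s] fun ω => Real.exp (A s ω) :=
      Real.continuous_exp.comp_stronglyMeasurable (hAa s)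
    have i1 : Integrable (fun ω => M t ω * Real.exp (A s ω)) P := by
      refine ((hM.integrable t).norm.const_mul (Real.exp C)).mono'
        ((hM.integrable t).aestronglyMeasurable.mul (hAe.mono (𝓕.le s)).aestronglyMeasurable) ?_
      filter_upwards [hexp, hRC] with ω h1 h2
      rw [norm_mul, mul_comm]
      -- If `M t ≠ 0` then `X t ≠ 0`, so the bound at `t` also controls the exponent at the earlier
      -- time `s`.
      by_cases hMt : M t ω = 0
      · simp [hMt]
      refine mul_le_mul_of_nonneg_right ?_ (norm_nonneg _)
      rw [Real.norm_eq_abs, abs_of_nonneg (Real.exp_nonneg _), Real.exp_le_exp]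
      refine (stieltjesIntegral_le_abs hR hst ω).trans (h2 t ?_)
      rw [h1]
      exact mul_ne_zero hMt (Real.exp_ne_zero _)
    have i2 : Integrable (fun ω => M s ω * Real.exp (A s ω)) P :=
      (hXi s).congr (hexp.mono fun ω h => h s)
    have i3 : Integrable (fun ω => (M t ω - M s ω) * Real.exp (A s ω)) P :=
      (i1.sub i2).congr (ae_of_all _ fun ω => (sub_mul _ _ _).symm)
    refine ⟨?_, i3⟩
    rw [← integral_indicator (𝓕.le s _ hB)]
    have := Martingale.integral_mul_sub_eq_zero hM hst (hAe.indicator hB)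
      ((i3.indicator (𝓕.le s _ hB)).congr (ae_of_all _ fun ω => ?_))
    · rw [← this]
      refine integral_congr_ae (ae_of_all _ fun ω => ?_)
      by_cases h : ω ∈ B <;> simp [h, mul_comm]
    · by_cases h : ω ∈ B <;> simp [h, mul_comm]
  have hsum : ∀ s h B, MeasurableSet[𝓕 s] B → ∀ n, ∫ ω in B, ∑ k ∈ Finset.range (n + 1),
      X (equipartition s h n (k + 1)) ω *
        (1 - Real.exp (-(A (equipartition s h n (k + 1)) ω - A (equipartition s h n k) ω))) ∂P =
      ∫ ω in B, (X (s + h) ω - X s ω) ∂P := by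
    intro s h B hB n
    have hp := monotone_equipartition s h n
    have hBk : ∀ k, MeasurableSet[𝓕 (equipartition s h n k)] B := fun k =>
      𝓕.mono (le_self_add) _ hB
    have hz := fun k => hincr _ _ (hp (Nat.le_succ k)) B (hBk k)
    have e : ∀ᵐ ω ∂P, X (s + h) ω - X s ω = ∑ k ∈ Finset.range (n + 1),
        ((M (equipartition s h n (k + 1)) ω - M (equipartition s h n k) ω) *
          Real.exp (A (equipartition s h n k) ω)) + ∑ k ∈ Finset.range (n + 1),
      X (equipartition s h n (k + 1)) ω *
        (1 - Real.exp (-(A (equipartition s h n (k + 1)) ω - A (equipartition s h n k) ω))) := by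
      filter_upwards [hexp] with ω hω
      rw [← Finset.sum_add_distrib]
      conv_lhs => rw [← equipartition_last s h n]
      conv_lhs => enter [2, 1]; rw [← equipartition_zero s h n]
      rw [← Finset.sum_range_sub fun k => X (equipartition s h n k) ω]
      refine Finset.sum_congr rfl fun k _ => ?_
      rw [hω, hω, neg_sub, Real.exp_sub]
      field_simp
      ring
    have hz0 : ∫ ω in B, ∑ k ∈ Finset.range (n + 1),
        ((M (equipartition s h n (k + 1)) ω - M (equipartition s h n k) ω) *
          Real.exp (A (equipartition s h n k) ω)) ∂P = 0 := by
      rw [integral_finsetSum _ fun k _ => (hz k).2.integrableOn]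
      exact Finset.sum_eq_zero fun k _ => (hz k).1
    rw [setIntegral_congr_ae (𝓕.le s _ hB) (e.mono fun ω h _ => h), integral_add, hz0, zero_add]
    · exact (integrable_finsetSum _ fun k _ => (hz k).2).integrableOn
    · exact (Integrable.of_bound (hsumm s h n).aestronglyMeasurable (C * Real.exp C * C)
        ((hbd s h).mono fun ω h => h n)).integrableOn
  refine martingale_of_setIntegral_eq (fun t => ((hX t).sub ((hX 0).mono (𝓕.mono zero_le))).sub
    (hDa t)) (fun t => ((hXi t).sub (hXi 0)).sub (hDi t)) fun s t hst B hB => ?_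
  obtain ⟨h, rfl⟩ := exists_add_of_le hst
  -- By `hsum` the integral of the sums does not depend on `n`, so it equals the integral of their
  -- limit.
  have h1 : Tendsto (fun _ : ℕ => ∫ ω in B, (X (s + h) ω - X s ω) ∂P) atTop
      (𝓝 (∫ ω in B, (D (s + h) ω - D s ω) ∂P)) := by
    refine (tendsto_integral_of_dominated_convergence (fun _ => C * Real.exp C * C)
      (fun n => (hsumm s h n).aestronglyMeasurable) (integrable_const _)
      (fun n => ae_restrict_of_ae ((hbd s h).mono fun ω h => h n))
      (ae_restrict_of_ae (hlim s h))).congr fun n => hsum s h B hB n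
  have h2 := tendsto_nhds_unique tendsto_const_nhds h1
  rw [integral_sub (hXi _).integrableOn (hXi _).integrableOn,
    integral_sub (hDi _).integrableOn (hDi _).integrableOn] at h2
  have i1 : ∀ u, ∫ ω in B, (X u ω - X 0 ω - D u ω) ∂P =
      ∫ ω in B, X u ω ∂P - ∫ ω in B, X 0 ω ∂P - ∫ ω in B, D u ω ∂P := by
    intro u
    have : Integrable (fun ω => X u ω - X 0 ω) P := (hXi u).sub (hXi 0)
    rw [integral_sub this.integrableOn (hDi u).integrableOn,
      integral_sub (hXi _).integrableOn (hXi _).integrableOn]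
  rw [i1, i1]
  linarith

end BoundedDecomposition

end MonotoneStopping

namespace MonotoneStopping

variable {Ω : Type*} {m0 : MeasurableSpace Ω}

/-! ### Localization of the additive decomposition. -/

section Localization

variable {𝓕 : Filtration ℝ≥0 m0} {P : Measure Ω}
  [IsProbabilityMeasure P] {V : Ω → StieltjesFunction ℝ≥0} {X M Y R : ℝ≥0 → Ω → ℝ}

theorem le_untopA_min_iff {u t : ℝ≥0} {x : WithTop ℝ≥0} :
    u ≤ (min (t : WithTop ℝ≥0) x).untopA ↔ u ≤ t ∧ (u : WithTop ℝ≥0) ≤ x := by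
  rw [← WithTop.coe_le_coe, coe_untopA_min, le_min_iff, WithTop.coe_le_coe]

theorem measurableSet_coe_le (x : WithTop ℝ≥0) :
    MeasurableSet {u : ℝ≥0 | (u : WithTop ℝ≥0) ≤ x} := by
  cases x with
  | top =>
    have : {u : ℝ≥0 | (u : WithTop ℝ≥0) ≤ ⊤} = Set.univ :=
      Set.eq_univ_of_forall fun u => show (u : WithTop ℝ≥0) ≤ ⊤ from le_top
    rw [this]
    exact MeasurableSet.univ
  | coe y =>
    have : {u : ℝ≥0 | (u : WithTop ℝ≥0) ≤ y} = Set.Iic y :=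
      Set.ext fun _ => WithTop.coe_le_coe
    rw [this]
    exact measurableSet_Iic

theorem measurableSet_Iic_prod_le {Ω : Type*} {m : MeasurableSpace Ω} {i : ℝ≥0} {σ : Ω → ℝ≥0}
    (hσ : Measurable σ) : MeasurableSet {p : Set.Iic i × Ω | (p.1 : ℝ≥0) ≤ σ p.2} :=
  measurableSet_le (measurable_subtype_coe.comp measurable_fst) (hσ.comp measurable_snd)

/-- The rate `H` up to and including the time `τ`, and `0` after `τ`. -/
noncomputable def stoppedRate (H : ℝ≥0 → Ω → ℝ) (τ : Ω → WithTop ℝ≥0) (t : ℝ≥0) (ω : Ω) : ℝ :=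
  {u : ℝ≥0 | (u : WithTop ℝ≥0) ≤ τ ω}.indicator (fun u => H u ω) t

theorem setIntegral_indicator_coe_le (μ : Measure ℝ≥0) (y : ℝ≥0 → ℝ) (x : WithTop ℝ≥0) (t : ℝ≥0) :
    ∫ u in Set.Ioc 0 t, {u : ℝ≥0 | (u : WithTop ℝ≥0) ≤ x}.indicator y u ∂μ =
      ∫ u in Set.Ioc 0 (min (t : WithTop ℝ≥0) x).untopA, y u ∂μ := by
  rw [setIntegral_indicator (measurableSet_coe_le x)]
  congr 2
  ext u
  simp only [Set.mem_inter_iff, Set.mem_Ioc, Set.mem_ofPred_eq, le_untopA_min_iff, and_assoc]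

theorem isStronglyProgressive_stoppedRate (hR : IsStronglyProgressive 𝓕 R) {τ : Ω → WithTop ℝ≥0}
    (hτ : IsStoppingTime 𝓕 τ) : IsStronglyProgressive 𝓕 (stoppedRate R τ) := by
  intro i
  have hσ : Measurable[𝓕 i] fun ω => (min (i : WithTop ℝ≥0) (τ ω)).untopA :=
    (((isStoppingTime_const 𝓕 i).min hτ).measurable_of_le fun ω => min_le_left _ _).untopA
  have := (hR i).indicator (measurableSet_Iic_prod_le hσ)
  convert! this using 1
  ext p
  simp only [stoppedRate, Set.indicator_apply, Set.mem_ofPred_eq, le_untopA_min_iff]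
  simp only [Set.mem_Iic.1 p.1.2, true_and]

theorem locallyIntegrable_stoppedRate (hR : LocallyIntegrable V R) (τ : Ω → WithTop ℝ≥0) :
    LocallyIntegrable V (stoppedRate R τ) := fun ω t =>
  (hR ω t).indicator (measurableSet_coe_le (τ ω))

theorem abs_stoppedRate (τ : Ω → WithTop ℝ≥0) (t : ℝ≥0) (ω : Ω) :
    |stoppedRate R τ t ω| =
      {u : ℝ≥0 | (u : WithTop ℝ≥0) ≤ τ ω}.indicator (fun u => |R u ω|) t := by
  simp only [stoppedRate, Set.indicator_apply]
  split_ifs <;> simp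

theorem stieltjesIntegral_stoppedRate (τ : Ω → WithTop ℝ≥0) (t : ℝ≥0) (ω : Ω) :
    stieltjesIntegral V (stoppedRate R τ) t ω =
      stieltjesIntegral V R (min (t : WithTop ℝ≥0) (τ ω)).untopA ω :=
  setIntegral_indicator_coe_le _ _ _ _

theorem stieltjesIntegral_mul_stoppedRate (τ : Ω → WithTop ℝ≥0) {A : Set Ω} {ω : Ω} (hω : ω ∈ A)
    (t : ℝ≥0) :
    stieltjesIntegral V
        (fun u ω => A.indicator (stoppedProcess X τ u) ω * stoppedRate R τ u ω) t ω =
      stieltjesIntegral V (fun u ω => X u ω * R u ω) (min (t : WithTop ℝ≥0) (τ ω)).untopA ω := by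
  simp only [stieltjesIntegral]
  rw [← setIntegral_indicator_coe_le]
  congr 1 with u
  rw [Set.indicator_of_mem hω]
  by_cases h : (u : WithTop ℝ≥0) ≤ τ ω
  · rw [stoppedProcess_eq_of_le h, stoppedRate, Set.indicator_of_mem (by exact h),
      Set.indicator_of_mem (by exact h)]
  · rw [stoppedRate, Set.indicator_of_notMem (by exact h), Set.indicator_of_notMem (by exact h),
      mul_zero]

/-- The localizing sequence for the decomposition of `X = M exp (∫ R dV)`: the first time at which
`X > n` or `∫ |R| dV ≥ n`. -/
noncomputable def localizingTime (V : Ω → StieltjesFunction ℝ≥0) (X R : ℝ≥0 → Ω → ℝ) (n : ℕ) :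
    Ω → WithTop ℝ≥0 := fun ω =>
  min (hittingAfter X (Set.Ioi (n : ℝ)) 0 ω)
    (hittingAfter (fun t ω => -stieltjesIntegral V (fun u ω => |R u ω|) t ω)
      (Set.Iic (-(n : ℝ))) 0 ω)

theorem monotone_stieltjesIntegral_abs (hR : LocallyIntegrable V R) (ω : Ω) :
    Monotone fun t => stieltjesIntegral V (fun u ω => |R u ω|) t ω := fun _ t hst =>
  setIntegral_mono_set (hR ω t).abs (ae_of_all _ fun _ => abs_nonneg _)
    (Set.Ioc_subset_Ioc_right hst).eventuallyLE

omit [IsProbabilityMeasure P] in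
theorem isLocalizingSequence_localizingTime [𝓕.IsRightContinuous]
    (hV : StronglyAdapted 𝓕 fun t ω => V ω t) (hX : StronglyAdapted 𝓕 X)
    (hcX : ∀ ω, Continuous fun t => X t ω) (hRp : IsStronglyProgressive 𝓕 R)
    (hR : LocallyIntegrable V R) :
    IsLocalizingSequence 𝓕 (localizingTime V X R) P where
  isStoppingTime n := by
    -- `∫ |R| dV` may have jumps, but its negative is antitone, so its hitting time is still a
    -- stopping time.
    refine (isStoppingTime_hittingAfter_of_isOpen hX hcX isOpen_Ioi).min
      (isStoppingTime_hittingAfter_of_antitone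
        (stronglyAdapted_stieltjesIntegral hV hRp.norm).neg (fun ω => ?_) _)
    exact (monotone_stieltjesIntegral_abs hR ω).neg
  mono := by
    refine ae_of_all _ fun ω n k hnk => min_le_min (hittingAfter_anti X 0 ?_ ω)
      (hittingAfter_anti _ 0 ?_ ω)
    · exact Set.Ioi_subset_Ioi (by exact_mod_cast hnk)
    · exact Set.Iic_subset_Iic.2 (neg_le_neg (by exact_mod_cast hnk))
  tendsto_top := by
    refine ae_of_all _ fun ω => (WithTop.tendsto_nhds_top_iff _).2 fun t => ?_
    obtain ⟨C, hC⟩ := (isCompact_Icc (a := 0) (b := t + 1)).exists_bound_of_continuousOn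
      (hcX ω).continuousOn
    have hT := monotone_stieltjesIntegral_abs hR ω
    filter_upwards [eventually_gt_atTop
      ⌈max C (stieltjesIntegral V (fun u ω => |R u ω|) (t + 1) ω)⌉₊]
      with n hn
    have hn' := Nat.lt_of_ceil_lt hn
    refine (WithTop.coe_lt_coe.2 (lt_add_one t)).trans_le (not_lt.1 fun h => ?_)
    rcases min_lt_iff.1 h with h | h
    · obtain ⟨s, hs, hsn⟩ := hittingAfter_lt_iff.1 h
      have h1 := (le_abs_self _).trans (hC s ⟨hs.1, hs.2.le⟩)
      exact absurd (Set.mem_Ioi.1 hsn) (not_lt.2 (h1.trans ((le_max_left _ _).trans hn'.le)))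
    · obtain ⟨s, hs, hsn⟩ := hittingAfter_lt_iff.1 h
      have h1 := neg_le_neg_iff.1 (Set.mem_Iic.1 hsn)
      exact absurd (h1.trans (hT hs.2.le)) (not_le.2 ((le_max_right _ _).trans_lt hn'))

omit [IsProbabilityMeasure P] in
theorem HasMulDoobMeyer.mul_measure_singleton (h : HasMulDoobMeyer 𝓕 P V X M Y R) :
    ∀ᵐ ω ∂P, ∀ u, 0 < u → X u ω ≠ 0 → (V ω).measure.real {u} * R u ω = 0 := by
  filter_upwards [h.eq_mul_exp] with ω hω u hu hxu
  exact mul_measure_singleton_eq_zero_of_eq_mul_exp (h.locallyIntegrable ω) (h.continuous ω)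
    (h.continuous_martingale ω) hω hu hxu

/-- The bounded case applies to `X` and `M` stopped at the localizing time and the rate `R` cut off
there. The indicator discards paths with localizing time `0`, on which `X 0` may exceed `n`. -/
theorem HasMulDoobMeyer.martingale_stopped [𝓕.IsRightContinuous]
    (h : HasMulDoobMeyer 𝓕 P V X M Y R) (hV : StronglyAdapted 𝓕 fun t ω => V ω t) (n : ℕ) :
    Martingale (stoppedProcess (fun t => {ω | ⊥ < localizingTime V X R n ω}.indicator
      fun ω => X t ω - X 0 ω - stieltjesIntegral V Y t ω) (localizingTime V X R n)) 𝓕 P := by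
  set ρ := localizingTime V X R n with hρdef
  set A := {ω | ⊥ < ρ ω} with hAdef
  have hρ : IsStoppingTime 𝓕 ρ := (isLocalizingSequence_localizingTime (P := P) hV h.adapted
    h.continuous h.progressive h.locallyIntegrable).isStoppingTime n
  have hA : MeasurableSet[𝓕 0] A := hρ.measurableSet_gt 0
  have hMs : Martingale (fun t => A.indicator (stoppedProcess M ρ t)) 𝓕 P :=
    Martingale.indicator (Martingale.stoppedProcess h.martingale h.continuous_martingale hρ) hA
  have hcs : ∀ {Z : ℝ≥0 → Ω → ℝ}, (∀ ω, Continuous fun t => Z t ω) → ∀ ω,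
      Continuous fun t => A.indicator (stoppedProcess Z ρ t) ω := by
    intro Z hZ ω
    by_cases hω : ω ∈ A
    · simp only [Set.indicator_of_mem hω]
      exact continuous_stoppedProcess hZ ρ ω
    · simp only [Set.indicator_of_notMem hω]
      exact continuous_const
  have hXs : StronglyAdapted 𝓕 fun t => A.indicator (stoppedProcess X ρ t) := fun t =>
    (IsStronglyProgressive.stronglyAdapted_stoppedProcess
      (h.adapted.isStronglyProgressive_of_continuous h.continuous) hρ t).indicator
      (𝓕.mono zero_le _ hA)
  have hmin : ∀ (t : ℝ≥0) ω,
      ((min (t : WithTop ℝ≥0) (ρ ω)).untopA : WithTop ℝ≥0) ≤ ρ ω := fun t ω =>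
    (coe_untopA_min _ _).trans_le (min_le_right _ _)
  have key := Martingale.sub_drift_of_bounded hMs (hcs h.continuous_martingale) hV hXs
    (hcs h.continuous) (isStronglyProgressive_stoppedRate h.progressive hρ)
    (locallyIntegrable_stoppedRate h.locallyIntegrable ρ) ?_ (C := n) ?_ ?_
  · convert! key using 1
    ext t ω
    by_cases hω : ω ∈ A
    · rw [stieltjesIntegral_mul_stoppedRate ρ hω]
      simp only [stoppedProcess, Set.indicator_of_mem hω]
      congr 2
      · rw [le_zero_iff.1 (untopA_min_le 0 (ρ ω))]
      · ext u ω
        rw [mul_comm, h.quotient]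
    · simp [stoppedProcess, Set.indicator_of_notMem hω, stieltjesIntegral]
  · filter_upwards [h.eq_mul_exp] with ω hω t
    rw [stieltjesIntegral_stoppedRate]
    by_cases hωA : ω ∈ A
    · simp only [Set.indicator_of_mem hωA]
      exact hω _
    · simp [Set.indicator_of_notMem hωA]
  · refine ae_of_all _ fun ω t => ?_
    by_cases hω : ω ∈ A
    · rw [Set.indicator_of_mem hω]
      have h0 : X 0 ω ∉ Set.Ioi (n : ℝ) := notMem_closure_of_lt_hittingAfter
        (lt_of_lt_of_le (show (0 : WithTop ℝ≥0) < ρ ω from hω) (min_le_left _ _))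
      have := mem_closure_compl_of_le_hittingAfter (h.continuous ω)
        ((hmin t ω).trans (min_le_left _ _)) (Or.inr h0)
      rw [Set.compl_Ioi, closure_Iic] at this
      rw [abs_of_nonneg (by exact h.nonneg _ ω)]
      exact this
    · simp [Set.indicator_of_notMem hω]
  · filter_upwards [h.mul_measure_singleton] with ω hjump t ht
    have hω : ω ∈ A := by
      by_contra hω
      exact ht (Set.indicator_of_notMem hω _)
    rw [Set.indicator_of_mem hω] at ht
    simp_rw [abs_stoppedRate]
    rw [setIntegral_indicator_coe_le]
    rcases eq_zero_or_pos (min (t : WithTop ℝ≥0) (ρ ω)).untopA with hv | hv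
    · rw [hv]
      simp
    -- Strictly before the localizing time `∫ |R| dV` is below `n`; at that time it cannot jump,
    -- because `X ≠ 0` there.
    refine setIntegral_Ioc_le_of_forall_lt (fun u => (h.locallyIntegrable ω u).abs) hv ?_
      fun w hw => ?_
    · have := hjump _ hv ht
      rcases mul_eq_zero.1 this with h0 | h0
      · rw [h0, zero_mul]
      · rw [h0, abs_zero, mul_zero]
    · have := notMem_closure_of_lt_hittingAfter
        ((WithTop.coe_lt_coe.2 hw.2).trans_le ((hmin t ω).trans (min_le_right _ _)))
      exact (neg_lt_neg_iff.1 (not_le.1 this)).le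

theorem HasMulDoobMeyer.hasDoobMeyer [𝓕.IsRightContinuous]
    (h : HasMulDoobMeyer 𝓕 P V X M Y R) (hV : StronglyAdapted 𝓕 fun t ω => V ω t) :
    HasDoobMeyer 𝓕 P V X Y where
  adapted := h.adapted
  continuous := h.continuous
  locallyIntegrable ω t := by
    refine (integrable_mul_of_bounded_path (h.locallyIntegrable ω) (h.continuous ω) t).congr
      (ae_of_all _ fun u => (mul_comm _ _).trans (h.quotient u ω))
  adapted_drift := by
    refine stronglyAdapted_stieltjesIntegral hV ?_
    convert! (h.progressive.mul (h.adapted.isStronglyProgressive_of_continuous h.continuous))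
    exact (h.quotient _ _).symm
  continuous_drift := by
    filter_upwards [h.mul_measure_singleton] with ω hω
    refine continuous_setIntegral_Ioc (fun t => ?_) fun u hu => ?_
    · refine (integrable_mul_of_bounded_path (h.locallyIntegrable ω) (h.continuous ω) t).congr
        (ae_of_all _ fun u => (mul_comm _ _).trans (h.quotient u ω))
    · rw [← h.quotient, ← mul_assoc]
      by_cases hx : X u ω = 0
      · rw [hx, mul_zero]
      · rw [hω u hu hx, zero_mul]
  localMartingale := ⟨localizingTime V X R,
    isLocalizingSequence_localizingTime hV h.adapted h.continuous h.progressive h.locallyIntegrable,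
    h.martingale_stopped hV⟩

end Localization

end MonotoneStopping

namespace MonotoneStopping

variable {Ω : Type*} {m0 : MeasurableSpace Ω}

/-! ### Optimality of the myopic rule for one process. -/

section Optimality

variable {𝓕 : Filtration ℝ≥0 m0} {P : Measure Ω}
  [IsProbabilityMeasure P] {V : Ω → StieltjesFunction ℝ≥0} {X M Y R : ℝ≥0 → Ω → ℝ}

theorem nonpos_of_myopicTime_lt {ω : Ω} (hR : Antitone fun t => R t ω) {t : ℝ≥0}
    (h : myopicTime R ω < t) : R t ω ≤ 0 := by
  obtain ⟨s, hs, hsR⟩ := hittingAfter_lt_iff.1 h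
  exact (hR hs.2.le).trans hsR

theorem pos_of_lt_myopicTime {ω : Ω} {t : ℝ≥0} (h : (t : WithTop ℝ≥0) < myopicTime R ω) :
    0 < R t ω :=
  not_le.1 (notMem_closure_of_lt_hittingAfter h)

omit [IsProbabilityMeasure P] in
theorem HasMulDoobMeyer.ae_martingale_nonneg (h : HasMulDoobMeyer 𝓕 P V X M Y R) :
    ∀ᵐ ω ∂P, ∀ t, 0 ≤ M t ω := by
  filter_upwards [h.eq_mul_exp] with ω hω t
  have := h.nonneg t ω
  rw [hω] at this
  exact nonneg_of_mul_nonneg_left this (Real.exp_pos _)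

omit [IsProbabilityMeasure P] in
theorem HasMulDoobMeyer.ae_eq_zero_iff (h : HasMulDoobMeyer 𝓕 P V X M Y R) :
    ∀ᵐ ω ∂P, ∀ t, X t ω = 0 ↔ M t ω = 0 := by
  filter_upwards [h.eq_mul_exp] with ω hω t
  rw [hω, mul_eq_zero_iff_right (Real.exp_ne_zero _)]

theorem HasMulDoobMeyer.ae_forall_eq_zero [𝓕.IsRightContinuous]
    (h : HasMulDoobMeyer 𝓕 P V X M Y R) :
    ∀ᵐ ω ∂P, ∀ s t, s ≤ t → X s ω = 0 → X t ω = 0 := by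
  filter_upwards [h.ae_eq_zero_iff, Martingale.ae_forall_eq_zero h.martingale
    h.continuous_martingale h.ae_martingale_nonneg] with ω h1 h2 s t hst hs
  exact (h1 t).2 (h2 s t hst ((h1 s).1 hs))

/-- Off the zeros, `X / M` is the exponential of `∫ R dV`, which grows while `R > 0` and falls after
the myopic time. The conditions on `t` are what `t = min τ* L` satisfies against `s ≤ L`. -/
theorem HasMulDoobMeyer.ae_le_mul_div [𝓕.IsRightContinuous]
    (h : HasMulDoobMeyer 𝓕 P V X M Y R) (hR : ∀ ω, Antitone fun t => R t ω) :
    ∀ᵐ ω ∂P, ∀ (s t : ℝ≥0), (t : WithTop ℝ≥0) ≤ myopicTime R ω →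
      (t < s → (t : WithTop ℝ≥0) = myopicTime R ω) →
      X s ω ≤ M s ω * (X (min s t) ω / M (min s t) ω) ∧
      M t ω * (X (min s t) ω / M (min s t) ω) ≤ X t ω := by
  filter_upwards [h.eq_mul_exp, h.ae_martingale_nonneg, h.mul_measure_singleton,
    Martingale.ae_forall_eq_zero h.martingale h.continuous_martingale h.ae_martingale_nonneg]
    with ω hexp hM0 hjump habs s t htτ hts
  have hdiv : ∀ u, M u ω ≠ 0 →
      X u ω / M u ω = Real.exp (stieltjesIntegral V R u ω) := fun u hu => by
    rw [hexp, mul_div_cancel_left₀ _ hu]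
  have hi := h.locallyIntegrable ω
  constructor
  · by_cases hMs : M s ω = 0
    · rw [hexp, hMs, zero_mul, zero_mul]
    -- Zeros of `M` are absorbing, so the quotient is a genuine one whenever `M s ≠ 0`.
    have hMρ : M (min s t) ω ≠ 0 := fun h0 => hMs (habs _ _ (min_le_left s t) h0)
    rw [hdiv _ hMρ, hexp]
    refine mul_le_mul_of_nonneg_left (Real.exp_le_exp.2 ?_) (hM0 s)
    rcases le_or_gt s t with hst | hst
    · rw [min_eq_left hst]
    · rw [min_eq_right hst.le, ← sub_nonpos]
      refine (setIntegral_Ioc_sub hi hst.le).trans_le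
        (setIntegral_nonpos measurableSet_Ioc fun u hu => ?_)
      refine nonpos_of_myopicTime_lt (hR ω) ?_
      rw [← hts hst]
      exact WithTop.coe_lt_coe.2 hu.1
  · by_cases hMt : M t ω = 0
    · rw [hMt, zero_mul]
      exact h.nonneg t ω
    have hMρ : M (min s t) ω ≠ 0 := fun h0 => hMt (habs _ _ (min_le_right s t) h0)
    rw [hdiv _ hMρ, hexp]
    refine mul_le_mul_of_nonneg_left (Real.exp_le_exp.2 ?_) (hM0 t)
    rcases le_or_gt t s with hst | hst
    · rw [min_eq_right hst]
    · rw [min_eq_left hst.le]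
      have hXt : X t ω ≠ 0 := by
        rw [hexp]
        exact mul_ne_zero hMt (Real.exp_ne_zero _)
      -- Positivity of `R` is known only strictly before the myopic time, which may be `t`; since `X
      -- t ≠ 0`, the integral has no jump at `t`.
      have := setIntegral_Ioc_le_of_forall_lt (r := fun u => -R u ω) (fun u => (hi u).neg) hst
        (c := -stieltjesIntegral V R s ω) ?_ fun w hw => ?_
      · rw [integral_neg] at this
        exact neg_le_neg_iff.1 this
      · rw [mul_neg, hjump t (zero_le.trans_lt hst) hXt, neg_zero]
      · rw [integral_neg, neg_le_neg_iff, ← sub_nonneg]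
        refine (setIntegral_nonneg measurableSet_Ioc fun u hu => ?_).trans_eq
          (setIntegral_Ioc_sub hi hw.1.le).symm
        exact (pos_of_lt_myopicTime
          ((WithTop.coe_lt_coe.2 (hu.2.trans_lt hw.2)).trans_le htτ)).le

theorem gainAt_min_coe (X : ℝ≥0 → Ω → ℝ) (σ : Ω → WithTop ℝ≥0) (L : ℝ≥0) (ω : Ω) :
    gainAt X (fun ω => min (σ ω) (L : WithTop ℝ≥0)) ω =
      ENNReal.ofReal (X (min (L : WithTop ℝ≥0) (σ ω)).untopA ω) := by
  rw [gainAt, if_neg (ne_top_of_le_ne_top WithTop.coe_ne_top (min_le_right _ _)), stoppedValue,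
    min_comm]

theorem HasMulDoobMeyer.expectedGain_min_le [𝓕.IsRightContinuous]
    (h : HasMulDoobMeyer 𝓕 P V X M Y R) (hR : ∀ ω, Antitone fun t => R t ω)
    {σ : Ω → WithTop ℝ≥0} (hσ : IsStoppingTime 𝓕 σ) (hτ : IsStoppingTime 𝓕 (myopicTime R))
    (L : ℝ≥0) :
    expectedGain P X (fun ω => min (σ ω) (L : WithTop ℝ≥0)) ≤
      expectedGain P X (fun ω => min (myopicTime R ω) (L : WithTop ℝ≥0)) := by
  simp only [expectedGain, gainAt_min_coe]
  set s : Ω → ℝ≥0 := fun ω => (min (L : WithTop ℝ≥0) (σ ω)).untopA with hs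
  set t : Ω → ℝ≥0 := fun ω => (min (L : WithTop ℝ≥0) (myopicTime R ω)).untopA with ht
  have hsS : IsStoppingTime 𝓕 fun ω => (s ω : WithTop ℝ≥0) := isStoppingTime_untopA_min hσ L
  have htS : IsStoppingTime 𝓕 fun ω => (t ω : WithTop ℝ≥0) := isStoppingTime_untopA_min hτ L
  have hρS : IsStoppingTime 𝓕 fun ω => ((min (s ω) (t ω) : ℝ≥0) : WithTop ℝ≥0) := by
    simpa only [WithTop.coe_min] using hsS.min htS
  have hsL : ∀ ω, s ω ≤ L := fun ω => untopA_min_le _ _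
  have htL : ∀ ω, t ω ≤ L := fun ω => untopA_min_le _ _
  set f : Ω → ℝ≥0∞ := fun ω =>
    ENNReal.ofReal (X (min (s ω) (t ω)) ω / M (min (s ω) (t ω)) ω) with hf
  have hfm : Measurable[hρS.measurableSpace] f := by
    have hx := measurable_stoppedValue
      (h.adapted.isStronglyProgressive_of_continuous h.continuous) hρS
    have hm := measurable_stoppedValue
      (h.martingale.stronglyAdapted.isStronglyProgressive_of_continuous h.continuous_martingale) hρS
    exact (hx.div hm).ennreal_ofReal
  have hfs : Measurable[hsS.measurableSpace] f := hfm.mono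
    (hρS.measurableSpace_mono hsS fun ω => WithTop.coe_le_coe.2 (min_le_left _ _)) le_rfl
  have hft : Measurable[htS.measurableSpace] f := hfm.mono
    (hρS.measurableSpace_mono htS fun ω => WithTop.coe_le_coe.2 (min_le_right _ _)) le_rfl
  have hM0 := h.ae_martingale_nonneg
  have hcmp : ∀ᵐ ω ∂P, X (s ω) ω ≤ M (s ω) ω * (X (min (s ω) (t ω)) ω / M (min (s ω) (t ω)) ω) ∧
      M (t ω) ω * (X (min (s ω) (t ω)) ω / M (min (s ω) (t ω)) ω) ≤ X (t ω) ω := by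
    filter_upwards [h.ae_le_mul_div hR] with ω hω
    refine hω (s ω) (t ω) ((coe_untopA_min _ _).trans_le (min_le_right _ _)) fun hlt => ?_
    -- If `t < s ≤ L`, the cap `L` is not active and `t` is the myopic time itself.
    refine (coe_untopA_min _ _).trans (min_eq_right (not_lt.1 fun hL => ?_))
    have htLeq : (t ω : WithTop ℝ≥0) = L := (coe_untopA_min _ _).trans (min_eq_left hL.le)
    exact absurd (hlt.trans_le (hsL ω)) (WithTop.coe_eq_coe.1 htLeq).not_lt
  calc ∫⁻ ω, ENNReal.ofReal (X (s ω) ω) ∂P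
      ≤ ∫⁻ ω, ENNReal.ofReal (M (s ω) ω) * f ω ∂P := by
        refine lintegral_mono_ae ?_
        filter_upwards [hcmp, hM0] with ω h1 h2
        rw [hf, ← ENNReal.ofReal_mul (h2 _)]
        exact ENNReal.ofReal_le_ofReal h1.1
    _ = ∫⁻ ω, ENNReal.ofReal (M L ω) * f ω ∂P :=
        Martingale.lintegral_mul_stopped h.martingale h.continuous_martingale hM0 hsS hsL hfs
    _ = ∫⁻ ω, ENNReal.ofReal (M (t ω) ω) * f ω ∂P :=
        (Martingale.lintegral_mul_stopped h.martingale h.continuous_martingale hM0 htS htL hft).symm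
    _ ≤ ∫⁻ ω, ENNReal.ofReal (X (t ω) ω) ∂P := by
        refine lintegral_mono_ae ?_
        filter_upwards [hcmp, hM0] with ω h1 h2
        rw [hf, ← ENNReal.ofReal_mul (h2 _)]
        exact ENNReal.ofReal_le_ofReal h1.2

/-- For finite `σ` the capped gains are eventually constant; for `σ = ⊤` the liminf over all real
times is at most that along the integers. -/
theorem gainAt_le_liminf (X : ℝ≥0 → Ω → ℝ) (σ : Ω → WithTop ℝ≥0) (ω : Ω) :
    gainAt X σ ω ≤
      liminf (fun n : ℕ => gainAt X (fun ω => min (σ ω) ((n : ℝ≥0) : WithTop ℝ≥0)) ω) atTop := by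
  simp_rw [gainAt_min_coe]
  rcases eq_or_ne (σ ω) ⊤ with hσ | hσ
  · rw [gainAt, if_pos hσ, hσ]
    have : ∀ n : ℕ, (min (((n : ℝ≥0)) : WithTop ℝ≥0) ⊤).untopA = (n : ℝ≥0) := fun n => by
      rw [min_eq_left le_top]; rfl
    simp_rw [this]
    exact liminf_le_liminf_of_le (f := atTop) (g := Filter.map (fun n : ℕ => (n : ℝ≥0)) atTop)
      tendsto_natCast_atTop_atTop
  · rw [gainAt, if_neg hσ]
    obtain ⟨u, hu⟩ := WithTop.ne_top_iff_exists.1 hσ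
    refine le_of_eq (Tendsto.liminf_eq (tendsto_const_nhds.congr' ?_)).symm
    filter_upwards [eventually_ge_atTop ⌈u⌉₊] with n hn
    rw [stoppedValue, min_eq_right]
    rw [← hu]
    exact WithTop.coe_le_coe.2 (Nat.ceil_le.1 hn)

omit [IsProbabilityMeasure P] in
theorem expectedGain_le_liminf (hX : StronglyAdapted 𝓕 X) (hc : ∀ ω, Continuous fun t => X t ω)
    {σ : Ω → WithTop ℝ≥0} (hσ : IsStoppingTime 𝓕 σ) :
    expectedGain P X σ ≤ liminf
      (fun n : ℕ => expectedGain P X fun ω => min (σ ω) ((n : ℝ≥0) : WithTop ℝ≥0)) atTop := by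
  refine (lintegral_mono fun ω => gainAt_le_liminf X σ ω).trans (lintegral_liminf_le fun n => ?_)
  rw [funext (gainAt_min_coe X σ n)]
  exact ((stronglyMeasurable_stoppedValue_of_le (hX.isStronglyProgressive_of_continuous hc)
    ((isStoppingTime_const 𝓕 (n : ℝ≥0)).min hσ) fun ω => min_le_left _ _).mono
    (𝓕.le _)).measurable.ennreal_ofReal

/-- Fatou's lemma bounds `E X_σ` by the liminf of the capped gains, the capped comparison replaces
`σ` by the myopic time, and (V1) removes the cap. -/
theorem HasMulDoobMeyer.isOptimal_myopicTime [𝓕.IsRightContinuous]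
    (h : HasMulDoobMeyer 𝓕 P V X M Y R) (hR : ∀ ω, Antitone fun t => R t ω)
    (hV1 : ConditionV1 P X (myopicTime R)) : IsOptimal 𝓕 P X (myopicTime R) := by
  have hτ : IsStoppingTime 𝓕 (myopicTime R) :=
    isStoppingTime_hittingAfter_of_antitone h.progressive.stronglyAdapted hR 0
  refine ⟨hτ, le_antisymm (le_iSup₂_of_le _ hτ le_rfl) (iSup₂_le fun σ hσ => ?_)⟩
  obtain ⟨l, hl, hle⟩ := hV1
  have hl' := hl.comp (tendsto_natCast_atTop_atTop (R := ℝ≥0))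
  refine (expectedGain_le_liminf h.adapted h.continuous hσ).trans (le_trans ?_ hle)
  rw [← hl'.liminf_eq]
  exact liminf_le_liminf (Eventually.of_forall fun n => h.expectedGain_min_le hR hσ hτ n)

end Optimality

/-! ### Products of decompositions. -/

section Products

variable {𝓕 : Filtration ℝ≥0 m0} {P : Measure Ω}
  [IsProbabilityMeasure P] {V : Ω → StieltjesFunction ℝ≥0}

theorem hasMulDoobMeyer_prod [𝓕.IsRightContinuous] {m : ℕ} {X M Y R : Fin m → ℝ≥0 → Ω → ℝ}
    (hX : ∀ i, HasMulDoobMeyer 𝓕 P V (X i) (M i) (Y i) (R i))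
    (hindep : iIndepFun (fun i ω (t : ℝ≥0) => M i t ω) P) :
    HasMulDoobMeyer 𝓕 P V (prodProcess X) (prodProcess M) (prodDrift X Y) (sumProcess R) where
  nonneg t ω := Finset.prod_nonneg fun i _ => (hX i).nonneg t ω
  adapted t := Finset.stronglyMeasurable_fun_prod _ fun i _ => (hX i).adapted t
  continuous ω := continuous_finsetProd _ fun i _ => (hX i).continuous ω
  martingale := martingale_finsetProd (fun i => (hX i).martingale)
    (fun i => (hX i).continuous_martingale) hindep _
  continuous_martingale ω := continuous_finsetProd _ fun i _ => (hX i).continuous_martingale ω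
  progressive := IsStronglyProgressive.finsetSum fun i _ => (hX i).progressive
  locallyIntegrable ω t := integrable_finsetSum _ fun i _ => (hX i).locallyIntegrable ω t
  quotient t ω := by
    simp only [sumProcess, prodProcess, prodDrift, Finset.sum_mul]
    refine Finset.sum_congr rfl fun i hi => ?_
    rw [← Finset.mul_prod_erase _ _ hi, ← mul_assoc, (hX i).quotient]
  eq_mul_exp := by
    filter_upwards [ae_all_iff.2 fun i => (hX i).eq_mul_exp] with ω hω t
    simp only [stieltjesIntegral, sumProcess, prodProcess]
    rw [integral_finsetSum _ fun i _ => (hX i).locallyIntegrable ω t, Real.exp_sum,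
      ← Finset.prod_mul_distrib]
    exact Finset.prod_congr rfl fun i _ => hω i t

theorem hittingAfter_eq_min_of_mem_iff {Z Z₁ Z₂ : ℝ≥0 → Ω → ℝ} {S S₁ S₂ : Set ℝ} {ω : Ω}
    (h : ∀ t, Z t ω ∈ S ↔ Z₁ t ω ∈ S₁ ∨ Z₂ t ω ∈ S₂) :
    hittingAfter Z S 0 ω = min (hittingAfter Z₁ S₁ 0 ω) (hittingAfter Z₂ S₂ 0 ω) := by
  refine eq_of_forall_gt_iff fun c => ?_
  rw [min_lt_iff]
  cases c with
  | top =>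
    simp only [lt_top_iff_ne_top, ne_eq, hittingAfter_eq_top_iff, h]
    grind
  | coe c =>
    simp only [hittingAfter_lt_iff, h]
    grind

end Products

end MonotoneStopping

theorem proposition3p4 {Ω : Type*} {m0 : MeasurableSpace Ω} (P : Measure Ω) [IsProbabilityMeasure P]
    (𝓕 : Filtration ℝ≥0 m0) [𝓕.IsRightContinuous]
    -- the increasing adapted process `V`, the same for all `i`
    (V : Ω → StieltjesFunction ℝ≥0) (hV : StronglyAdapted 𝓕 fun t ω => V ω t)
    -- `Xⁱ = Mⁱ exp (∫ Rⁱ dV)` with `Rⁱ = Yⁱ / Xⁱ`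
    {m : ℕ} (X M Y R : Fin m → ℝ≥0 → Ω → ℝ)
    (hX : ∀ i, MonotoneStopping.HasMulDoobMeyer 𝓕 P V (X i) (M i) (Y i) (R i))
    (hindep : iIndepFun (fun i ω => fun t : ℝ≥0 => (X i t ω, M i t ω)) P)
    (hR : ∀ i ω, Antitone fun t => R i t ω) :
    -- the product has a multiplicative Doob-Meyer decomposition with rate `∑ᵢ Yⁱ / Xⁱ` ...
    (MonotoneStopping.HasMulDoobMeyer 𝓕 P V
        (MonotoneStopping.prodProcess X) (MonotoneStopping.prodProcess M)
        (MonotoneStopping.prodDrift X Y) (MonotoneStopping.sumProcess R) ∧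
      -- ... the product problem is a monotone case problem ...
      MonotoneStopping.IsMonotoneCase 𝓕 P V
        (MonotoneStopping.prodProcess X) (MonotoneStopping.prodDrift X Y) ∧
      (∀ ω (t : ℝ≥0), MonotoneStopping.myopicTime (MonotoneStopping.sumProcess R) ω < t →
        MonotoneStopping.sumProcess R t ω ≤ 0) ∧
      -- ... with myopic rule `τ* = inf {t : ∑ᵢ Yⁱ_t / Xⁱ_t ≤ 0}` (up to the first zero of the
      -- product, where the drift rate vanishes, too)
      IsStoppingTime 𝓕 (MonotoneStopping.myopicTime (MonotoneStopping.sumProcess R)) ∧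
      ∀ ω, MonotoneStopping.myopicTime (MonotoneStopping.prodDrift X Y) ω =
        min (MonotoneStopping.myopicTime (MonotoneStopping.sumProcess R) ω)
          (hittingAfter (MonotoneStopping.prodProcess X) {0} 0 ω)) ∧
    -- under (V1), the myopic rule is optimal
    (MonotoneStopping.ConditionV1 P (MonotoneStopping.prodProcess X)
        (MonotoneStopping.myopicTime (MonotoneStopping.sumProcess R)) →
      MonotoneStopping.IsOptimal 𝓕 P (MonotoneStopping.prodProcess X)
        (MonotoneStopping.myopicTime (MonotoneStopping.sumProcess R))) := by
  have hprod := MonotoneStopping.hasMulDoobMeyer_prod hX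
    (hindep.comp (fun _ f t => (f t).2) fun _ =>
      measurable_pi_lambda _ fun t => (measurable_pi_apply t).snd)
  have hsum : ∀ ω, Antitone fun t => MonotoneStopping.sumProcess R t ω := fun ω s t hst =>
    Finset.sum_le_sum fun i _ => hR i ω hst
  have hmem : ∀ ω t, MonotoneStopping.prodDrift X Y t ω ≤ 0 ↔
      MonotoneStopping.sumProcess R t ω ≤ 0 ∨ MonotoneStopping.prodProcess X t ω = 0 := by
    intro ω t
    rw [← hprod.quotient]
    rcases (hprod.nonneg t ω).eq_or_lt with h | h
    · simp [← h]
    · simp only [h.ne', or_false, mul_nonpos_iff, h.le, h.not_ge, and_true, and_false, false_or]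
  refine ⟨⟨hprod, ⟨hprod.hasDoobMeyer hV, ?_⟩,
    fun ω t => MonotoneStopping.nonpos_of_myopicTime_lt (hsum ω),
    MonotoneStopping.isStoppingTime_hittingAfter_of_antitone hprod.progressive.stronglyAdapted
      hsum 0,
    fun ω => MonotoneStopping.hittingAfter_eq_min_of_mem_iff (hmem ω)⟩,
    hprod.isOptimal_myopicTime hsum⟩
  -- A nonpositive rate persists because the sum is antitone, a zero of the product because zeros
  -- are almost surely absorbing.
  filter_upwards [hprod.ae_forall_eq_zero] with ω hω t ht
  obtain ⟨s, hs, hsY⟩ := hittingAfter_lt_iff.1 ht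
  exact (hmem ω t).2 (((hmem ω s).1 hsY).imp (fun h => (hsum ω hs.2.le).trans h)
    fun h => hω s t hs.2.le h)
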